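/- **Theorem 2.** Let $V\in L^\infty_{\rm comp}(\mathbb R^3;\mathbb C)$, i.e. $V$ is a (complex valued) element of $L^\infty(\mathbb R^3)$ vanishing almost everywhere outside a compact set, and let $P_V=-\Delta+V$ on $L^2(\mathbb R^3)$ with domain $H^2(\mathbb R^3)$. Then there is a constant $C$ such that for $\Im\lambda>C$ the inverse $R_V(\lambda)=(P_V-\lambda^2)^{-1}:L^2(\mathbb R^3)\to L^2(\mathbb R^3)$ exists as a bounded operator and depends holomorphically on $\lambda$, and $R_V(\lambda)$ continues to a meromorphic family of operators $$R_V(\lambda):L^2_{\rm comp}(\mathbb R^3)\longrightarrow L^2_{\rm loc}(\mathbb R^3),\qquad \lambda\in\mathbb C.$$ That is, there are a closed discrete set $S\subset\mathbb C$, disjoint from $\{\Im\lambda>C\}$, and a family of operators $R(\lambda):L^2_{\rm comp}(\mathbb R^3)\to L^2_{\rm loc}(\mathbb R^3)$, holomorphic for $\lambda\in\mathbb C\setminus S$, with $R(\lambda)f=(P_V-\lambda^2)^{-1}f$ for $\Im\lambda>C$ and $f\in L^2_{\rm comp}(\mathbb R^3)$, such that for each $\lambda_0\in S$ there are $J\ge1$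 and continuous operators $A_1,\dots,A_J:L^2_{\rm comp}(\mathbb R^3)\to L^2_{\rm loc}(\mathbb R^3)$ of finite rank, $A_J\neq0$, with $$R(\lambda)=\sum_{j=1}^J\frac{A_j}{(\lambda-\lambda_0)^j}+A_0(\lambda)$$ for $\lambda\ne\lambda_0$ near $\lambda_0$, where $\lambda\mapsto A_0(\lambda):L^2_{\rm comp}(\mathbb R^3)\to L^2_{\rm loc}(\mathbb R^3)$ is holomorphic near $\lambda_0$. The set $S$ of poles is determined by $V$, and so is $R(\lambda)$ for $\lambda\notin S$; the elements of $S$ are called the scattering resonances of $V$. Here a family $A(\lambda):L^2_{\rm comp}(\mathbb R^3)\to L^2_{\rm loc}(\mathbb R^3)$ is holomorphic on an open set $U$ if for all compact $K,L\subset\mathbb R^3$ the operators $\mathbf 1_KA(\lambda)\mathbf 1_L$, $\lambda\in U$, are bounded on $L^2(\mathbb R^3)$ and depend holomorphically on $\lambda\in U$ in operator norm; a single operator $A$ is continuous if all $\mathbf 1_KA\mathbf 1_L$ are bounded on $L^2(\mathbb R^3)$. -/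

import Mathlib

open MeasureTheory Set
open scoped ENNReal SchwartzMap

noncomputable section

/-- Three dimensional Euclidean space. -/
abbrev E3 : Type := EuclideanSpace ℝ (Fin 3)

/-- The Hilbert space `L²(ℝ³)` of complex valued functions. -/
abbrev L2 : Type := Lp ℂ 2 (volume : Measure E3)

/-- `L^∞(ℝ³)`, complex valued. -/
abbrev LInfty : Type := Lp ℂ ∞ (volume : Measure E3)

/-- A function vanishing almost everywhere outside of a compact set. -/
def AECompactSupport (f : E3 → ℂ) : Prop :=
  ∃ K : Set E3, IsCompact K ∧ ∀ᵐ x ∂(volume : Measure E3), x ∉ K → f x = 0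

/-- `L²_comp(ℝ³)`: the compactly supported elements of `L²(ℝ³)`. -/
def L2Comp : Submodule ℂ L2 where
  carrier := {f | AECompactSupport f}
  zero_mem' := by
    refine ⟨∅, isCompact_empty, ?_⟩
    filter_upwards [Lp.coeFn_zero ℂ 2 (volume : Measure E3)] with x _ _
    simp
  add_mem' := by
    rintro f g ⟨K, hK, hf⟩ ⟨L, hL, hg⟩
    refine ⟨K ∪ L, hK.union hL, ?_⟩
    filter_upwards [hf, hg, Lp.coeFn_add f g] with x h1 h2 h3 hx
    rw [mem_union, not_or] at hx
    rw [h3, Pi.add_apply, h1 hx.1, h2 hx.2, add_zero]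
  smul_mem' := by
    rintro c f ⟨K, hK, hf⟩
    refine ⟨K, hK, ?_⟩
    filter_upwards [hf, Lp.coeFn_smul c f] with x h1 h2 hx
    rw [h2, Pi.smul_apply, h1 hx, smul_zero]

/-- The (classes of) measurable functions that are square integrable on every compact set, as a
subspace of the space of all measurable functions modulo equality almost everywhere. -/
def L2LocSubmodule : Submodule ℂ (E3 →ₘ[(volume : Measure E3)] ℂ) where
  carrier := {f | ∀ K : Set E3, IsCompact K → MemLp f 2 (volume.restrict K)}
  zero_mem' := by
    intro K _
    exact (memLp_congr_ae (ae_restrict_of_ae AEEqFun.coeFn_zero)).2 MemLp.zero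
  add_mem' := by
    intro f g hf hg K hK
    exact (memLp_congr_ae (ae_restrict_of_ae (AEEqFun.coeFn_add f g))).2 ((hf K hK).add (hg K hK))
  smul_mem' := by
    intro c f hf K hK
    exact (memLp_congr_ae (ae_restrict_of_ae (AEEqFun.coeFn_smul c f))).2
      ((hf K hK).const_smul c)

/-- The vector space `L²_loc(ℝ³)`. -/
def L2Loc : Type := L2LocSubmodule

instance : AddCommGroup L2Loc := inferInstanceAs (AddCommGroup L2LocSubmodule)

instance : Module ℂ L2Loc := inferInstanceAs (Module ℂ L2LocSubmodule)

/-- The measurable function (modulo equality almost everywhere) underlying `f ∈ L²_loc`. -/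
def L2Loc.toAEEqFun (f : L2Loc) : E3 →ₘ[(volume : Measure E3)] ℂ := f.1

theorem L2Loc.toAEEqFun_add (f g : L2Loc) : (f + g).toAEEqFun = f.toAEEqFun + g.toAEEqFun := rfl

theorem L2Loc.toAEEqFun_smul (c : ℂ) (f : L2Loc) : (c • f).toAEEqFun = c • f.toAEEqFun := rfl

theorem L2Loc.memLp_indicator (K : TopologicalSpace.Compacts E3) (f : L2Loc) :
    MemLp ((K : Set E3).indicator f.toAEEqFun) 2 volume :=
  (memLp_indicator_iff_restrict K.isCompact.measurableSet).2 (f.2 K K.isCompact)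

/-- Multiplication by the characteristic function of a compact set, `L²_loc → L²`. -/
def cutLoc (K : TopologicalSpace.Compacts E3) : L2Loc →ₗ[ℂ] L2 where
  toFun f := (L2Loc.memLp_indicator K f).toLp _
  map_add' f g := by
    rw [← MemLp.toLp_add]
    apply MemLp.toLp_congr
    filter_upwards [AEEqFun.coeFn_add f.toAEEqFun g.toAEEqFun] with x hx
    rw [Pi.add_apply, L2Loc.toAEEqFun_add]
    by_cases h : x ∈ (K : Set E3) <;> simp [h, hx]
  map_smul' c f := by
    rw [RingHom.id_apply, ← MemLp.toLp_const_smul]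
    apply MemLp.toLp_congr
    filter_upwards [AEEqFun.coeFn_smul c f.toAEEqFun] with x hx
    rw [Pi.smul_apply, L2Loc.toAEEqFun_smul]
    by_cases h : x ∈ (K : Set E3) <;> simp [h, hx]

/-- Multiplication by the characteristic function of a compact set, `L² → L²_comp`. -/
def cutComp (K : TopologicalSpace.Compacts E3) : L2 →ₗ[ℂ] L2Comp where
  toFun f := ⟨((Lp.memLp f).indicator K.isCompact.measurableSet).toLp _, K, K.isCompact, by
    filter_upwards [((Lp.memLp f).indicator K.isCompact.measurableSet).coeFn_toLp] with x hx h
    rw [hx, Set.indicator_of_notMem h]⟩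
  map_add' f g := by
    apply Subtype.ext
    rw [Submodule.coe_add]
    dsimp only
    rw [← MemLp.toLp_add]
    refine MemLp.toLp_congr _ _ ?_
    filter_upwards [Lp.coeFn_add f g] with x hx
    rw [Pi.add_apply]
    by_cases h : x ∈ (K : Set E3)
    · rw [Set.indicator_of_mem h, Set.indicator_of_mem h, Set.indicator_of_mem h, hx, Pi.add_apply]
    · simp [h]
  map_smul' c f := by
    apply Subtype.ext
    rw [RingHom.id_apply, Submodule.coe_smul]
    dsimp only
    rw [← MemLp.toLp_const_smul]
    refine MemLp.toLp_congr _ _ ?_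
    filter_upwards [Lp.coeFn_smul c f] with x hx
    by_cases h : x ∈ (K : Set E3) <;> simp [h, hx]

/-- The truncation `1_K A 1_L : L² → L²` of an operator `A : L²_comp → L²_loc`. -/
def truncation (K L : TopologicalSpace.Compacts E3) (A : L2Comp →ₗ[ℂ] L2Loc) : L2 →ₗ[ℂ] L2 :=
  cutLoc K ∘ₗ A ∘ₗ cutComp L

/-- Continuity of `A : L²_comp → L²_loc` (inductive limit topology on the source, Fréchet topology
on the target): all truncations `1_K A 1_L` are bounded operators on `L²`. -/
def IsContinuousOperator (A : L2Comp →ₗ[ℂ] L2Loc) : Prop :=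
  ∀ K L : TopologicalSpace.Compacts E3, ∃ B : L2 →L[ℂ] L2, ∀ f : L2, B f = truncation K L A f

/-- A family of operators `L²_comp → L²_loc` is holomorphic on the open set `U` when it consists,
for parameters in `U`, of continuous operators and all truncations `1_K A(z) 1_L` are holomorphic
on `U` with values in the Banach space of bounded operators on `L²`. -/
def IsHolomorphicFamilyOn (A : ℂ → L2Comp →ₗ[ℂ] L2Loc) (U : Set ℂ) : Prop :=
  ∀ K L : TopologicalSpace.Compacts E3, ∃ B : ℂ → L2 →L[ℂ] L2,
    DifferentiableOn ℂ B U ∧ ∀ z ∈ U, ∀ f : L2, B z f = truncation K L (A z) f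

/-- `A` has a pole of finite rank at `z₀`: in a punctured neighbourhood of `z₀`,
`A(z) = ∑_{j=1}^J A_j / (z - z₀)^j + A₀(z)` with `J ≥ 1`, continuous operators
`A_j : L²_comp → L²_loc` of finite rank, `A_J ≠ 0`, and `A₀` holomorphic near `z₀`. -/
def HasFiniteRankPoleAt (A : ℂ → L2Comp →ₗ[ℂ] L2Loc) (z₀ : ℂ) : Prop :=
  ∃ J : ℕ, 1 ≤ J ∧ ∃ (a : ℕ → L2Comp →ₗ[ℂ] L2Loc) (A₀ : ℂ → L2Comp →ₗ[ℂ] L2Loc) (U : Set ℂ),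
    (∀ j ∈ Finset.Icc 1 J, IsContinuousOperator (a j) ∧ FiniteDimensional ℂ (LinearMap.range (a j))) ∧
    a J ≠ 0 ∧ IsOpen U ∧ z₀ ∈ U ∧ IsHolomorphicFamilyOn A₀ U ∧
    ∀ z ∈ U, z ≠ z₀ → A z = ∑ j ∈ Finset.Icc 1 J, ((z - z₀) ^ j)⁻¹ • a j + A₀ z

/-- `A` is a meromorphic family of operators `L²_comp → L²_loc` on `ℂ` whose set of poles is
exactly the (closed and discrete) set `S`. The values `A z` for `z ∈ S` carry no meaning. -/
def IsMeromorphicFamily (A : ℂ → L2Comp →ₗ[ℂ] L2Loc) (S : Set ℂ) : Prop :=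
  IsClosed S ∧ IsDiscrete S ∧ IsHolomorphicFamilyOn A Sᶜ ∧ ∀ z₀ ∈ S, HasFiniteRankPoleAt A z₀

open scoped Laplacian in
/-- The graph of the unbounded operator `P_V = -Δ + V` on `L²(ℝ³)` with domain `H²(ℝ³)`:
`u ∈ H²` and `P_V u = g`. -/
def SchrodingerGraph (V : LInfty) (u g : L2) : Prop :=
  TemperedDistribution.MemSobolev 2 2 (u : 𝓢'(E3, ℂ)) ∧
    -Δ (u : 𝓢'(E3, ℂ)) + ((V • u : L2) : 𝓢'(E3, ℂ)) = (g : 𝓢'(E3, ℂ))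

/-- The bounded operator `T` is the inverse `(P_V - z²)⁻¹ : L² → L²`: for all `f` and `u`,
`T f = u` if and only if `u ∈ H²` and `P_V u - z² u = f`. -/
def IsResolvent (V : LInfty) (z : ℂ) (T : L2 →L[ℂ] L2) : Prop :=
  ∀ f u : L2, T f = u ↔ SchrodingerGraph V u (f + z ^ 2 • u)

/-- `R` is a meromorphic family `L²_comp → L²_loc` on `ℂ`, with set of poles `S`, which continues
the holomorphic family `(-Δ + V - z²)⁻¹ : L² → L²` defined for `Im z ≫ 1`. -/
def IsScatteringResolvent (V : LInfty) (R : ℂ → L2Comp →ₗ[ℂ] L2Loc) (S : Set ℂ) : Prop :=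
  IsMeromorphicFamily R S ∧
    ∃ (C : ℝ) (T : ℂ → L2 →L[ℂ] L2), DifferentiableOn ℂ T {z | C < z.im} ∧
      ∀ z : ℂ, C < z.im → z ∉ S ∧ IsResolvent V z (T z) ∧
        ∀ f : L2Comp, (R z f).toAEEqFun = (T z f : L2)

/-- The scattering resonances of `V`: the poles of the meromorphically continued resolvent. -/
def scatteringResonances (V : LInfty) : Set ℂ :=
  {z | ∃ (R : ℂ → L2Comp →ₗ[ℂ] L2Loc) (S : Set ℂ), IsScatteringResolvent V R S ∧ z ∈ S}

end

/-! For `Im z > 0` the free resolvent `R₀(z) = (-Δ - z²)⁻¹` on `ℝ³` has the kernel `exp(iz|x-y|) /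
(4π|x-y|)`. This kernel is entire in `z`, and its singularity is locally square integrable in
dimension three. Cut off to compact sets it therefore defines bounded operators that are entire in
`z` (`isHolomorphicFamilyOn_radialOp`) and Hilbert-Schmidt, hence norm limits of finite rank
operators (`isFiniteRankLimit_of_kernel`). The kernel formula is computed only for `z = iκ`, where
the Green function is a superposition of Gaussians (`fourier_greenFunction`). The identity theorem
carries it to the half plane (`outgoing_eq_freeResolvent`).

Let `K` be compact and carry `V`. For large `Im z` the resolvent equation is `u = R₀(f - Vu)`, and
it is solved by `R(z) = R₀ - R₀ 1_K (1 + V R₀ 1_K)⁻¹ V R₀` (`continuedResolvent_eq`). Every factor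
except the inverse is entire. The operator `V R₀ 1_K` is an entire family of limits of finite rank
operators, and `1 + V R₀ 1_K` is invertible by a Neumann series when `Im z > ‖V‖ + 1`. Analytic
Fredholm theory (`exists_meromorphic_inverse`) makes the inverse meromorphic on `ℂ`, with a singular
part factoring through some `ℂⁿ`. Expanding the four holomorphic factors of that part at `z₀` yields
a principal part of finite rank (`hasFiniteRankPrincipalPartAt_sandwich`).

A point where `1 + V R₀ 1_K` is not invertible may still be a removable singularity of `R`; such
points are filled in, and the others are the poles. For uniqueness, two continuations agree high in
the half plane, and the complement of both pole sets is open and connected, since closed discrete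
sets are countable. So the continuations agree off the poles, and a genuine pole cannot coincide
with a regular point of the other family. -/

noncomputable section

/-! ### The graph of `-Δ + V` on the Fourier side -/

open FourierTransform in
/-- Two square integrable functions represent the distributions `g • h` and `k` exactly when
`g h = k` almost everywhere. -/
theorem smulLeftCLM_eq_iff {g : E3 → ℂ} (hg : g.HasTemperateGrowth) (h k : L2) :
    TemperedDistribution.smulLeftCLM ℂ g (h : 𝓢'(E3, ℂ)) = (k : 𝓢'(E3, ℂ)) ↔
      ∀ᵐ x, g x * h x = k x := by
  constructor
  · intro H
    have hloc : LocallyIntegrable (fun x => g x * h x - k x) volume := by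
      refine LocallyIntegrable.sub ?_ ((Lp.memLp k).locallyIntegrable (by norm_num))
      have := ((Lp.memLp h).locallyIntegrable (by norm_num)).locallyIntegrableOn univ
      have := this.continuousOn_mul (g := g) hg.1.continuous.continuousOn isOpen_univ.isLocallyClosed
      exact locallyIntegrableOn_univ.1 this
    have h0 : ∀ᵐ x, g x * h x - k x = 0 := by
      apply ae_eq_zero_of_integral_contDiff_smul_eq_zero hloc
      intro φ hφ hc
      have hc₁ : HasCompactSupport (Complex.ofRealCLM ∘ φ) := hc.comp_left rfl
      have hs₁ : ContDiff ℝ ((⊤ : ℕ∞) : WithTop ℕ∞) (Complex.ofRealCLM ∘ φ) := by fun_prop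
      have := congrArg (fun u : 𝓢'(E3, ℂ) => u (hc₁.toSchwartzMap hs₁)) H
      simp only [TemperedDistribution.smulLeftCLM_apply_apply, Lp.toTemperedDistribution_apply,
        SchwartzMap.smulLeftCLM_apply_apply hg] at this
      have hcont : Continuous φ := hφ.continuous
      have i1 : Integrable (fun x => (φ x : ℂ) * (g x * h x)) := by
        have hh := (Lp.memLp h).locallyIntegrable (by norm_num)
        have := hh.integrable_smul_left_of_hasCompactSupport (g := fun x => (φ x : ℂ) * g x)
          ((Complex.continuous_ofReal.comp hcont).mul hg.1.continuous)
          (HasCompactSupport.mul_right (f := fun x => (φ x : ℂ)) hc₁)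
        simpa [mul_assoc] using this
      have i2 : Integrable (fun x => (φ x : ℂ) * k x) := by
        have hh := (Lp.memLp k).locallyIntegrable (by norm_num)
        exact hh.integrable_smul_left_of_hasCompactSupport (g := fun x => (φ x : ℂ))
          (Complex.continuous_ofReal.comp hcont) hc₁
      have e : ∀ x, φ x • (g x * h x - k x) = (φ x : ℂ) * (g x * h x) - (φ x : ℂ) * k x := by
        intro x
        rw [Complex.real_smul]
        ring
      simp_rw [e]
      rw [integral_sub i1 i2, sub_eq_zero]
      exact (integral_congr_ae (ae_of_all _ fun x => by simp; ring)).trans this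
    filter_upwards [h0] with x hx
    linear_combination hx
  · intro H
    ext φ
    simp only [TemperedDistribution.smulLeftCLM_apply_apply, Lp.toTemperedDistribution_apply,
        SchwartzMap.smulLeftCLM_apply_apply hg]
    apply integral_congr_ae
    filter_upwards [H] with x hx
    rw [← hx]
    simp
    ring

open FourierTransform in
/-- The graph of `-Δ + V` on the Fourier transform side. -/
theorem schrodingerGraph_iff (V : LInfty) (u g : L2) :
    SchrodingerGraph V u g ↔
      ∀ᵐ ξ, ((2 * Real.pi) ^ 2 * ‖ξ‖ ^ 2 : ℂ) * (𝓕 u : L2) ξ = (𝓕 (g - (V • u : L2)) : L2) ξ := by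
  have hgr : (fun x : E3 => ((‖x‖ ^ 2 : ℝ) : ℂ)).HasTemperateGrowth := by fun_prop
  have hgr' : (fun x : E3 => ((2 * Real.pi) ^ 2 * ‖x‖ ^ 2 : ℂ)).HasTemperateGrowth := by
    have : (fun x : E3 => ((2 * Real.pi) ^ 2 * ‖x‖ ^ 2 : ℂ)) =
      fun x => (((2 * Real.pi) ^ 2 : ℝ) : ℂ) * ((‖x‖ ^ 2 : ℝ) : ℂ) := by ext; push_cast; ring
    rw [this]; fun_prop
  have key : (-(Laplacian.laplacian (u : 𝓢'(E3, ℂ))) + ((V • u : L2) : 𝓢'(E3, ℂ)) = (g : 𝓢'(E3, ℂ)))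
      ↔ ∀ᵐ ξ, ((2 * Real.pi) ^ 2 * ‖ξ‖ ^ 2 : ℂ) * (𝓕 u : L2) ξ
        = (𝓕 (g - (V • u : L2)) : L2) ξ := by
    rw [← smulLeftCLM_eq_iff hgr']
    rw [← Lp.fourier_toTemperedDistribution_eq, ← Lp.fourier_toTemperedDistribution_eq]
    have e1 : ((g - (V • u : L2) : L2) : 𝓢'(E3, ℂ)) = (g : 𝓢'(E3, ℂ)) - ((V • u : L2) : 𝓢'(E3, ℂ)) :=
      map_sub (Lp.toTemperedDistributionCLM ℂ volume 2) g (V • u : L2)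
    rw [e1, ← eq_sub_iff_add_eq, TemperedDistribution.laplacian_eq_fourierMultiplierCLM]
    have e2 : -(-(2 * Real.pi) ^ 2 •
        TemperedDistribution.fourierMultiplierCLM ℂ (fun x : E3 => ((‖x‖ ^ 2 : ℝ) : ℂ)) (u : 𝓢'(E3, ℂ)))
        = 𝓕⁻ (TemperedDistribution.smulLeftCLM ℂ (fun x : E3 => ((2 * Real.pi) ^ 2 * ‖x‖ ^ 2 : ℂ))
          (𝓕 (u : 𝓢'(E3, ℂ)))) := by
      have : (fun x : E3 => ((2 * Real.pi) ^ 2 * ‖x‖ ^ 2 : ℂ)) =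
        (((2 * Real.pi) ^ 2 : ℝ) : ℂ) • fun x : E3 => ((‖x‖ ^ 2 : ℝ) : ℂ) := by ext; simp
      rw [this, TemperedDistribution.smulLeftCLM_smul hgr, TemperedDistribution.fourierMultiplierCLM_apply,
        smul_apply, FourierTransform.fourierInv_smul, neg_smul, neg_neg]
      ext φ
      simp
    rw [e2]
    constructor
    · intro h
      have := congrArg (fun v => 𝓕 v) h
      simpa using this
    · intro h
      rw [h, FourierTransform.fourierInv_fourier_eq]
  constructor
  · rintro ⟨-, h⟩
    exact key.1 h
  · intro h
    refine ⟨?_, key.2 h⟩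
    rw [TemperedDistribution.memSobolev_iff_exists_smulLeftCLM_fourier]
    -- Membership in `H²` is automatic: the Sobolev weight is `1 + ‖ξ‖²`, and the equation expresses
    -- `‖ξ‖² û` as `(2π)⁻²` times the transform of the square integrable function `g - Vu`.
    refine ⟨𝓕 u + (((2 * Real.pi) ^ 2 : ℂ))⁻¹ • 𝓕 (g - (V • u : L2)), ?_⟩
    rw [Lp.fourier_toTemperedDistribution_eq, smulLeftCLM_eq_iff (by fun_prop)]
    filter_upwards [h, Lp.coeFn_add (𝓕 u) ((((2 * Real.pi) ^ 2 : ℂ))⁻¹ • 𝓕 (g - (V • u : L2))),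
      Lp.coeFn_smul ((((2 * Real.pi) ^ 2 : ℂ))⁻¹) (𝓕 (g - (V • u : L2)))] with ξ h1 h2 h3
    rw [h2, Pi.add_apply, h3, Pi.smul_apply, ← h1]
    have hpi : (Real.pi : ℂ) ≠ 0 := by exact_mod_cast Real.pi_ne_zero
    simp
    field_simp

/-! ### The free resolvent as a Fourier multiplier -/

/-- Multiplication by a bounded function on `L²`. -/
def mulOp (V : LInfty) : L2 →L[ℂ] L2 :=
  LinearMap.mkContinuous
    { toFun := fun f => V • f
      map_add' := fun f g => Lp.add_smul V f g
      map_smul' := fun c f => (Lp.smul_comm c V f).symm } ‖V‖ (fun f => Lp.norm_smul_le V f)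

theorem mulOp_apply (V : LInfty) (f : L2) : mulOp V f = V • f := rfl

theorem norm_mulOp_le (V : LInfty) : ‖mulOp V‖ ≤ ‖V‖ :=
  LinearMap.mkContinuous_norm_le _ (norm_nonneg _) _

/-- In the factorization `(a - z)(a + z)` both factors have imaginary part `± Im z`, because `a` is
real. This bounds the free resolvent by `(Im z)⁻²`. -/
theorem sq_im_le_norm_sq_sub_sq (a : ℝ) (z : ℂ) : z.im ^ 2 ≤ ‖(a : ℂ) ^ 2 - z ^ 2‖ := by
  have e : (a : ℂ) ^ 2 - z ^ 2 = (a - z) * (a + z) := by ring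
  rw [e, norm_mul, ← sq_abs, sq]
  apply mul_le_mul _ _ (abs_nonneg _) (norm_nonneg _)
  · simpa using Complex.abs_im_le_norm ((a : ℂ) - z)
  · simpa using Complex.abs_im_le_norm ((a : ℂ) + z)

/-- The symbol of the free resolvent. -/
def resolventSymbol (z : ℂ) (ξ : E3) : ℂ := ((2 * Real.pi) ^ 2 * ‖ξ‖ ^ 2 - z ^ 2)⁻¹

theorem norm_resolventSymbol_le {z : ℂ} (hz : 0 < z.im) (ξ : E3) :
    ‖resolventSymbol z ξ‖ ≤ (z.im ^ 2)⁻¹ := by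
  rw [resolventSymbol, norm_inv]
  have := sq_im_le_norm_sq_sub_sq (2 * Real.pi * ‖ξ‖) z
  push_cast at this
  rw [mul_pow] at this
  exact inv_anti₀ (by positivity) this

theorem resolventSymbol_denom_ne_zero {z : ℂ} (hz : 0 < z.im) (ξ : E3) :
    ((2 * Real.pi) ^ 2 * ‖ξ‖ ^ 2 - z ^ 2 : ℂ) ≠ 0 := by
  have := sq_im_le_norm_sq_sub_sq (2 * Real.pi * ‖ξ‖) z
  push_cast at this
  rw [mul_pow] at this
  rw [← norm_pos_iff]
  have h2 : 0 < z.im ^ 2 := by positivity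
  linarith

theorem memLp_resolventSymbol {z : ℂ} (hz : 0 < z.im) :
    MemLp (resolventSymbol z) ∞ (volume : Measure E3) := by
  refine memLp_top_of_bound ?_ _ (ae_of_all _ (norm_resolventSymbol_le hz))
  unfold resolventSymbol
  exact Measurable.aestronglyMeasurable (by fun_prop)

/-- The symbol of the free resolvent as an element of `L^∞`. -/
def resolventSymbolLp {z : ℂ} (hz : 0 < z.im) : LInfty := (memLp_resolventSymbol hz).toLp _

theorem norm_resolventSymbolLp_le {z : ℂ} (hz : 0 < z.im) :
    ‖resolventSymbolLp hz‖ ≤ (z.im ^ 2)⁻¹ := by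
  rw [resolventSymbolLp, Lp.norm_toLp]
  refine ENNReal.toReal_le_of_le_ofReal (by positivity) ?_
  rw [eLpNorm_exponent_top]
  refine eLpNormEssSup_le_of_ae_bound (ae_of_all _ (norm_resolventSymbol_le hz))

/-- The free resolvent `(-Δ - z²)⁻¹` for `Im z > 0`, as a Fourier multiplier (and `0` for other
`z`). -/
def freeResolvent (z : ℂ) : L2 →L[ℂ] L2 :=
  if hz : 0 < z.im then
    ((Lp.fourierTransformₗᵢ E3 ℂ).symm : L2 →L[ℂ] L2) ∘L mulOp (resolventSymbolLp hz) ∘L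
      ((Lp.fourierTransformₗᵢ E3 ℂ) : L2 →L[ℂ] L2)
  else 0

theorem freeResolvent_apply {z : ℂ} (hz : 0 < z.im) (f : L2) :
    freeResolvent z f = (Lp.fourierTransformₗᵢ E3 ℂ).symm
      (mulOp (resolventSymbolLp hz) (Lp.fourierTransformₗᵢ E3 ℂ f)) := by
  rw [freeResolvent, dif_pos hz]; rfl

open FourierTransform in
theorem fourier_freeResolvent {z : ℂ} (hz : 0 < z.im) (f : L2) :
    ∀ᵐ ξ, (𝓕 (freeResolvent z f) : L2) ξ = resolventSymbol z ξ * (𝓕 f : L2) ξ := by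
  have : 𝓕 (freeResolvent z f) = (resolventSymbolLp hz • 𝓕 f : L2) := by
    rw [freeResolvent_apply hz]
    exact (Lp.fourierTransformₗᵢ E3 ℂ).apply_symm_apply _
  rw [this]
  filter_upwards [Lp.coeFn_lpSMul (r := 2) (resolventSymbolLp hz) (𝓕 f),
    (memLp_resolventSymbol hz).coeFn_toLp] with ξ h1 h2
  rw [h1, Pi.smul_apply', resolventSymbolLp, h2, smul_eq_mul]

theorem norm_freeResolvent_le {z : ℂ} (hz : 0 < z.im) : ‖freeResolvent z‖ ≤ (z.im ^ 2)⁻¹ := by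
  refine ContinuousLinearMap.opNorm_le_bound _ (by positivity) fun f => ?_
  rw [freeResolvent_apply hz, LinearIsometryEquiv.norm_map]
  refine ((mulOp _).le_opNorm _).trans ?_
  rw [LinearIsometryEquiv.norm_map]
  gcongr
  exact (norm_mulOp_le _).trans (norm_resolventSymbolLp_le hz)

open FourierTransform in
/-- The graph of `-Δ + V` in terms of the free resolvent. -/
theorem schrodingerGraph_iff_eq_freeResolvent (V : LInfty) {z : ℂ} (hz : 0 < z.im) (u f : L2) :
    SchrodingerGraph V u (f + z ^ 2 • u) ↔ u = freeResolvent z (f - mulOp V u) := by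
  rw [schrodingerGraph_iff, mulOp_apply]
  have e : f + z ^ 2 • u - (V • u : L2) = (f - (V • u : L2)) + z ^ 2 • u := by abel
  rw [e]
  set h : L2 := f - (V • u : L2)
  have e2 : 𝓕 (h + z ^ 2 • u) = 𝓕 h + z ^ 2 • 𝓕 u := by
    rw [FourierTransform.fourier_add, FourierTransform.fourier_smul]
  rw [e2]
  have hadd : ∀ᵐ ξ, (𝓕 h + z ^ 2 • 𝓕 u : L2) ξ = (𝓕 h : L2) ξ + z ^ 2 * (𝓕 u : L2) ξ := by
    filter_upwards [Lp.coeFn_add (𝓕 h) (z ^ 2 • 𝓕 u), Lp.coeFn_smul (z ^ 2) (𝓕 u)] with ξ h1 h2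
    rw [h1, Pi.add_apply, h2, Pi.smul_apply, smul_eq_mul]
  constructor
  · intro H
    apply (Lp.fourierTransformₗᵢ E3 ℂ).injective
    change 𝓕 u = 𝓕 (freeResolvent z h)
    apply Lp.ext
    filter_upwards [H, fourier_freeResolvent hz h, hadd] with ξ h1 h2 h3
    rw [h2, resolventSymbol, eq_inv_mul_iff_mul_eq₀ (resolventSymbol_denom_ne_zero hz ξ)]
    rw [h3] at h1
    linear_combination h1
  · intro H
    have H' : 𝓕 u = 𝓕 (freeResolvent z h) := congrArg _ H
    filter_upwards [fourier_freeResolvent hz h, hadd] with ξ h2 h3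
    rw [← H', resolventSymbol, eq_inv_mul_iff_mul_eq₀ (resolventSymbol_denom_ne_zero hz ξ)] at h2
    rw [h3]
    linear_combination h2

/-! ### Two integrals over the half line -/

-- The primitives used below involve division by `s`, so their values at `0` are unrelated to their
-- limits there. Replacing `F` by its limit on `s ≤ 0` gives the one-sided continuity that the
-- fundamental theorem requires.
open Filter Topology in
theorem integral_Ioi_zero_of_hasDerivAt_of_nonneg {F F' : ℝ → ℝ} {l m : ℝ}
    (hF : ∀ s, 0 < s → HasDerivAt F (F' s) s) (h0 : Tendsto F (𝓝[>] 0) (𝓝 l))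
    (h1 : Tendsto F atTop (𝓝 m)) (hpos : ∀ s, 0 < s → 0 ≤ F' s) :
    IntegrableOn F' (Ioi 0) ∧ ∫ s in Ioi (0 : ℝ), F' s = m - l := by
  set g : ℝ → ℝ := fun s => if s ≤ 0 then l else F s with hg
  have hgF : ∀ s, 0 < s → g s = F s := fun s hs => by simp [hg, not_le.2 hs]
  have hcont : ContinuousWithinAt g (Ici 0) 0 := by
    rw [← continuousWithinAt_Ioi_iff_Ici, ContinuousWithinAt]
    have : g 0 = l := by simp [hg]
    rw [this]
    refine h0.congr' ?_
    filter_upwards [self_mem_nhdsWithin] with s hs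
    exact (hgF s hs).symm
  have hder : ∀ s ∈ Ioi (0 : ℝ), HasDerivAt g (F' s) s := by
    intro s hs
    refine (hF s hs).congr_of_eventuallyEq ?_
    filter_upwards [Ioi_mem_nhds hs] with t ht
    exact hgF t ht
  have htop : Tendsto g atTop (𝓝 m) := by
    refine h1.congr' ?_
    filter_upwards [eventually_gt_atTop 0] with s hs
    exact (hgF s hs).symm
  refine ⟨integrableOn_Ioi_deriv_of_nonneg hcont hder hpos htop, ?_⟩
  rw [integral_Ioi_of_hasDerivAt_of_nonneg hcont hder hpos htop]
  simp [hg]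

open Filter Topology in
theorem tendsto_inv_sq_nhdsGT_zero {A : ℝ} (hA : 0 < A) :
    Tendsto (fun s : ℝ => Real.exp (-A / s ^ 2)) (𝓝[>] 0) (𝓝 0) := by
  refine Real.tendsto_exp_atBot.comp ?_
  have h : Tendsto (fun s : ℝ => (s⁻¹) ^ 2) (𝓝[>] 0) atTop :=
    (tendsto_pow_atTop two_ne_zero).comp tendsto_inv_nhdsGT_zero
  refine (h.const_mul_atTop_of_neg (neg_lt_zero.2 hA)).congr fun s => ?_
  rw [inv_pow, div_eq_mul_inv]

open Filter Topology in
/-- `∫₀^∞ s⁻³ exp(-A/s²) ds = 1/(2A)`. -/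
theorem integral_inv_cube_mul_exp {A : ℝ} (hA : 0 < A) :
    IntegrableOn (fun s : ℝ => (s ^ 3)⁻¹ * Real.exp (-A / s ^ 2)) (Ioi 0) ∧
      ∫ s in Ioi (0 : ℝ), (s ^ 3)⁻¹ * Real.exp (-A / s ^ 2) = (2 * A)⁻¹ := by
  have h := integral_Ioi_zero_of_hasDerivAt_of_nonneg
    (F := fun s => (2 * A)⁻¹ * Real.exp (-A / s ^ 2))
    (F' := fun s : ℝ => (s ^ 3)⁻¹ * Real.exp (-A / s ^ 2)) (l := 0) (m := (2 * A)⁻¹) ?_ ?_ ?_ ?_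
  · simpa using h
  · intro s hs
    have h1 : HasDerivAt (fun s : ℝ => -A / s ^ 2) (2 * A / s ^ 3) s := by
      have := (hasDerivAt_const s (-A)).div (hasDerivAt_pow 2 s) (by positivity)
      convert! this using 1
      field_simp
      simp [mul_comm]
    convert! (h1.exp).const_mul ((2 * A)⁻¹) using 1
    field_simp
  · simpa using (tendsto_inv_sq_nhdsGT_zero hA).const_mul ((2 * A)⁻¹)
  · have h1 : Tendsto (fun s : ℝ => -A / s ^ 2) atTop (𝓝 0) :=
      tendsto_const_nhds.div_atTop (tendsto_pow_atTop two_ne_zero)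
    have := ((Real.continuous_exp.tendsto 0).comp h1).const_mul ((2 * A)⁻¹)
    simpa using this
  · intro s hs
    positivity

/-- The primitive of `exp(-x²)` vanishing at the origin. -/
def gaussPrimitive (x : ℝ) : ℝ := ∫ y in (0 : ℝ)..x, Real.exp (-1 * y ^ 2)

theorem hasDerivAt_gaussPrimitive (x : ℝ) :
    HasDerivAt gaussPrimitive (Real.exp (-x ^ 2)) x := by
  have hc : Continuous fun y : ℝ => Real.exp (-1 * y ^ 2) := by fun_prop
  have := intervalIntegral.integral_hasDerivAt_right (hc.intervalIntegrable 0 x)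
    (hc.stronglyMeasurableAtFilter _ _) hc.continuousAt
  rw [neg_one_mul] at this
  exact this

open Filter Topology in
theorem tendsto_gaussPrimitive_atTop :
    Tendsto gaussPrimitive atTop (𝓝 (Real.sqrt Real.pi / 2)) := by
  have := intervalIntegral_tendsto_integral_Ioi (0 : ℝ)
    (integrable_exp_neg_mul_sq (b := 1) one_pos).integrableOn tendsto_id
  rw [integral_gaussian_Ioi, div_one] at this
  exact this

theorem gaussPrimitive_neg (x : ℝ) : gaussPrimitive (-x) = -gaussPrimitive x := by
  have := intervalIntegral.integral_comp_neg (a := 0) (b := x)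
    (fun y : ℝ => Real.exp (-1 * y ^ 2))
  simp only [neg_sq, neg_zero] at this
  rw [gaussPrimitive, gaussPrimitive, this, intervalIntegral.integral_symm]

open Filter Topology in
theorem tendsto_gaussPrimitive_atBot :
    Tendsto gaussPrimitive atBot (𝓝 (-(Real.sqrt Real.pi / 2))) := by
  have := (tendsto_gaussPrimitive_atTop.comp tendsto_neg_atBot_atTop).neg
  refine this.congr fun x => ?_
  simp [gaussPrimitive_neg]

open Filter Topology in
/-- `∫₀^∞ exp(-a²s² - b²/s²) ds = √π/(2a) exp(-2ab)`. -/
theorem integral_exp_neg_sq_sub_inv_sq {a b : ℝ} (ha : 0 < a) (hb : 0 < b) :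
    ∫ s in Ioi (0 : ℝ), Real.exp (-(a ^ 2 * s ^ 2) - b ^ 2 / s ^ 2) =
      Real.sqrt Real.pi / (2 * a) * Real.exp (-(2 * a * b)) := by
  have hlim0 : Tendsto (fun s : ℝ => b / s) (𝓝[>] 0) atTop :=
    (tendsto_inv_nhdsGT_zero.const_mul_atTop hb).congr fun s => (div_eq_mul_inv _ _).symm
  have hlim0' : Tendsto (fun s : ℝ => a * s) (𝓝[>] 0) (𝓝 0) := by
    have : Tendsto (fun s : ℝ => a * s) (𝓝 0) (𝓝 (a * 0)) := (continuous_const_mul a).tendsto 0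
    rw [mul_zero] at this
    exact this.mono_left nhdsWithin_le_nhds
  have hlim1 : Tendsto (fun s : ℝ => b / s) atTop (𝓝 0) := tendsto_const_nhds.div_atTop tendsto_id
  have hlim1' : Tendsto (fun s : ℝ => a * s) atTop atTop := tendsto_id.const_mul_atTop ha
  -- The squares `(as ± b/s)²` differ from `a²s² + b²/s²` by `±2ab`, which the exponential
  -- prefactors cancel. The two derivatives thus carry the same exponential, with factors `a - b/s²`
  -- and `a + b/s²` adding up to `2a`. At `0` the arguments tend to `+∞` and `-∞`, at infinity both
  -- tend to `+∞`, so the `exp(2ab)` terms drop out of the difference.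
  have h := integral_Ioi_zero_of_hasDerivAt_of_nonneg
    (F := fun s => (2 * a)⁻¹ * (Real.exp (2 * a * b) * gaussPrimitive (a * s + b / s) +
      Real.exp (-(2 * a * b)) * gaussPrimitive (a * s - b / s)))
    (F' := fun s => Real.exp (-(a ^ 2 * s ^ 2) - b ^ 2 / s ^ 2))
    (l := (2 * a)⁻¹ * (Real.exp (2 * a * b) * (Real.sqrt Real.pi / 2) +
      Real.exp (-(2 * a * b)) * (-(Real.sqrt Real.pi / 2))))
    (m := (2 * a)⁻¹ * (Real.exp (2 * a * b) * (Real.sqrt Real.pi / 2) +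
      Real.exp (-(2 * a * b)) * (Real.sqrt Real.pi / 2))) ?_ ?_ ?_ ?_
  · rw [h.2]
    field_simp
    ring
  · intro s hs
    have hd : HasDerivAt (fun s : ℝ => b / s) (-b / s ^ 2) s := by
      have := (hasDerivAt_const s b).div (hasDerivAt_id s) hs.ne'
      convert! this using 1
      simp
    have hm : HasDerivAt (fun s : ℝ => a * s) a s := by
      simpa using (hasDerivAt_id s).const_mul a
    have h1 := (hasDerivAt_gaussPrimitive (a * s + b / s)).comp s (hm.add hd)
    have h2 := (hasDerivAt_gaussPrimitive (a * s - b / s)).comp s (hm.sub hd)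
    have h3 := ((h1.const_mul (Real.exp (2 * a * b))).add
      (h2.const_mul (Real.exp (-(2 * a * b))))).const_mul ((2 * a)⁻¹)
    convert! h3 using 1
    have e1 : Real.exp (2 * a * b) * Real.exp (-(a * s + b / s) ^ 2) =
        Real.exp (-(a ^ 2 * s ^ 2) - b ^ 2 / s ^ 2) := by
      rw [← Real.exp_add]
      congr 1
      field_simp
      ring
    have e2 : Real.exp (-(2 * a * b)) * Real.exp (-(a * s - b / s) ^ 2) =
        Real.exp (-(a ^ 2 * s ^ 2) - b ^ 2 / s ^ 2) := by
      rw [← Real.exp_add]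
      congr 1
      field_simp
      ring
    rw [← mul_assoc, ← mul_assoc, e1, e2]
    field_simp
    ring
  · refine (((tendsto_gaussPrimitive_atTop.comp ?_).const_mul _).add
      ((tendsto_gaussPrimitive_atBot.comp ?_).const_mul _)).const_mul _
    · exact hlim0'.add_atTop hlim0
    · exact (hlim0'.add_atBot (tendsto_neg_atTop_atBot.comp hlim0)).congr fun s =>
        (sub_eq_add_neg _ _).symm
  · refine (((tendsto_gaussPrimitive_atTop.comp ?_).const_mul _).add
      ((tendsto_gaussPrimitive_atTop.comp ?_).const_mul _)).const_mul _
    · exact hlim1'.atTop_add hlim1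
    · exact (hlim1'.atTop_add hlim1.neg).congr fun s => (sub_eq_add_neg _ _).symm
  · intro s hs
    positivity

/-! ### The Green function and its Fourier transform -/

/-- The Green function of `-Δ + κ²` on `ℝ³`. -/
def greenFunction (κ : ℝ) (x : E3) : ℂ := (Real.exp (-(κ * ‖x‖)) / (4 * Real.pi * ‖x‖) : ℝ)

/-- The integrand in the representation of the Green function as a superposition of Gaussians. -/
def greenIntegrand (κ : ℝ) (p : E3 × ℝ) : ℂ :=
  Complex.exp (-((p.2 ^ 2 / 4 : ℝ) : ℂ) * (‖p.1‖ : ℂ) ^ 2) * (Real.exp (-κ ^ 2 / p.2 ^ 2) : ℝ)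

theorem measurable_greenIntegrand (κ : ℝ) : Measurable (greenIntegrand κ) := by
  unfold greenIntegrand
  fun_prop

theorem greenIntegrand_eq (κ : ℝ) (x : E3) (s : ℝ) : greenIntegrand κ (x, s) =
    (Real.exp (-((‖x‖ / 2) ^ 2 * s ^ 2) - κ ^ 2 / s ^ 2) : ℝ) := by
  rw [greenIntegrand]
  push_cast
  rw [← Complex.exp_add]
  congr 1
  ring

theorem norm_greenIntegrand (κ : ℝ) (x : E3) (s : ℝ) : ‖greenIntegrand κ (x, s)‖ =
    Real.exp (-(s ^ 2 / 4) * ‖x‖ ^ 2) * Real.exp (-κ ^ 2 / s ^ 2) := by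
  rw [greenIntegrand_eq, Complex.norm_real, Real.norm_eq_abs, Real.abs_exp, ← Real.exp_add]
  congr 1
  ring

/-- The half line integral with `a = ‖x‖/2` and `b = κ` equals `√π/‖x‖ · exp(-κ‖x‖)`; the condition
`x ≠ 0` is what makes `a` positive. -/
theorem greenFunction_eq_integral {κ : ℝ} (hκ : 0 < κ) {x : E3} (hx : x ≠ 0) :
    greenFunction κ x = ((4 * Real.pi * Real.sqrt Real.pi)⁻¹ : ℝ) *
      ∫ s in Ioi (0 : ℝ), greenIntegrand κ (x, s) := by
  have hr : 0 < ‖x‖ := norm_pos_iff.2 hx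
  simp_rw [greenIntegrand_eq]
  rw [integral_complex_ofReal, integral_exp_neg_sq_sub_inv_sq (by positivity) hκ, greenFunction,
    ← Complex.ofReal_mul]
  congr 1
  have hpi : 0 < Real.pi := Real.pi_pos
  have : 2 * (‖x‖ / 2) * κ = κ * ‖x‖ := by ring
  rw [this]
  field_simp

/-- The mass of the Gaussian `exp(-s²‖x‖²/4)` in dimension three, the exponent being half the
dimension. -/
theorem rpow_gauss_const {s : ℝ} (hs : 0 < s) :
    (Real.pi / (s ^ 2 / 4)) ^ (3 / 2 : ℝ) = 8 * Real.pi * Real.sqrt Real.pi * (s ^ 3)⁻¹ := by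
  have hpi := Real.pi_pos
  have e : Real.pi / (s ^ 2 / 4) = (2 * Real.sqrt Real.pi / s) ^ 2 := by
    rw [div_pow, mul_pow, Real.sq_sqrt hpi.le]
    field_simp
    norm_num
  rw [e, ← Real.rpow_natCast, ← Real.rpow_mul (by positivity)]
  have : ((2 : ℕ) : ℝ) * (3 / 2) = ((3 : ℕ) : ℝ) := by norm_num
  rw [this, Real.rpow_natCast, div_pow, mul_pow]
  have h3 : Real.sqrt Real.pi ^ 3 = Real.pi * Real.sqrt Real.pi := by
    rw [pow_succ, Real.sq_sqrt hpi.le]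
  rw [h3]
  field_simp
  norm_num

/-- Integrating the norm in `x` first leaves a multiple of `s⁻³ exp(-κ²/s²)`, which is integrable on
the half line. This one fact gives both the integrability of the Green function and the use of
Fubini for its Fourier transform. -/
theorem integrable_greenIntegrand {κ : ℝ} (hκ : 0 < κ) :
    Integrable (greenIntegrand κ) ((volume : Measure E3).prod (volume.restrict (Ioi (0 : ℝ)))) := by
  rw [integrable_prod_iff' (measurable_greenIntegrand κ).aestronglyMeasurable]
  constructor
  · filter_upwards [ae_restrict_mem measurableSet_Ioi] with s hs
    have hs' : 0 < s := hs
    have := GaussianFourier.integrable_cexp_neg_mul_sq_norm_add (V := E3)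
      (b := ((s ^ 2 / 4 : ℝ) : ℂ)) (by rw [Complex.ofReal_re]; positivity) 0 0
    simp only [zero_mul, add_zero] at this
    exact this.mul_const ((Real.exp (-κ ^ 2 / s ^ 2) : ℝ) : ℂ)
  · have h := ((integral_inv_cube_mul_exp (A := κ ^ 2) (by positivity)).1).const_mul
      (8 * Real.pi * Real.sqrt Real.pi)
    refine Integrable.congr h ?_
    filter_upwards [ae_restrict_mem measurableSet_Ioi] with s hs
    have hs' : 0 < s := hs
    simp_rw [norm_greenIntegrand]
    rw [integral_mul_const, GaussianFourier.integral_rexp_neg_mul_sq_norm (by positivity)]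
    simp only [finrank_euclideanSpace, Fintype.card_fin, Nat.cast_ofNat]
    rw [rpow_gauss_const hs']
    ring

theorem greenFunction_ae_eq {κ : ℝ} (hκ : 0 < κ) :
    (fun x : E3 => (((4 * Real.pi * Real.sqrt Real.pi)⁻¹ : ℝ) : ℂ) *
      ∫ s in Ioi (0 : ℝ), greenIntegrand κ (x, s)) =ᵐ[volume] greenFunction κ := by
  have : ∀ᵐ x : E3, x ≠ 0 := by simp [ae_iff]
  filter_upwards [this] with x hx
  exact (greenFunction_eq_integral hκ hx).symm

theorem integrable_greenFunction {κ : ℝ} (hκ : 0 < κ) : Integrable (greenFunction κ) :=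
  ((integrable_greenIntegrand hκ).integral_prod_left.const_mul
    (((4 * Real.pi * Real.sqrt Real.pi)⁻¹ : ℝ) : ℂ)).congr (greenFunction_ae_eq hκ)

-- After exchanging the integrals, each Gaussian is transformed explicitly. What remains is `∫ s⁻³
-- exp(-A/s²) ds = 1/(2A)` with `A = 4π²‖ξ‖² + κ²`, and the constants combine to `1/A`.
open FourierTransform in
theorem fourier_greenFunction {κ : ℝ} (hκ : 0 < κ) (ξ : E3) :
    𝓕 (greenFunction κ) ξ = resolventSymbol (κ * Complex.I) ξ := by
  rw [Real.fourier_eq]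
  set c : ℂ := (((4 * Real.pi * Real.sqrt Real.pi)⁻¹ : ℝ) : ℂ) with hc
  have e1 : ∫ x : E3, Real.fourierChar (-inner ℝ x ξ) • greenFunction κ x =
      ∫ x : E3, c * ∫ s in Ioi (0 : ℝ), Real.fourierChar (-inner ℝ x ξ) • greenIntegrand κ (x, s) := by
    apply integral_congr_ae
    filter_upwards [greenFunction_ae_eq hκ] with x hx
    rw [← hx]
    simp_rw [Circle.smul_def]
    rw [integral_smul]
    simp only [smul_eq_mul]
    ring
  have hint : Integrable (fun p : E3 × ℝ => Real.fourierChar (-inner ℝ p.1 ξ) • greenIntegrand κ p)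
      ((volume : Measure E3).prod (volume.restrict (Ioi (0 : ℝ)))) := by
    refine (integrable_greenIntegrand hκ).mono ?_ (ae_of_all _ fun p => by simp)
    have h1 : Continuous fun p : E3 × ℝ => Real.fourierChar (-inner ℝ p.1 ξ) :=
      Real.continuous_fourierChar.comp (by fun_prop)
    exact h1.aestronglyMeasurable.smul (measurable_greenIntegrand κ).aestronglyMeasurable
  have hA : 0 < (2 * Real.pi) ^ 2 * ‖ξ‖ ^ 2 + κ ^ 2 := by positivity
  have e2 : ∀ s ∈ Ioi (0 : ℝ), ∫ x : E3, Real.fourierChar (-inner ℝ x ξ) • greenIntegrand κ (x, s) =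
      ((8 * Real.pi * Real.sqrt Real.pi * ((s ^ 3)⁻¹ *
        Real.exp (-((2 * Real.pi) ^ 2 * ‖ξ‖ ^ 2 + κ ^ 2) / s ^ 2)) : ℝ) : ℂ) := by
    intro s hs
    have hs' : 0 < s := hs
    have h := fourier_gaussian_innerProductSpace (V := E3) (b := ((s ^ 2 / 4 : ℝ) : ℂ))
      (by rw [Complex.ofReal_re]; positivity) ξ
    rw [Real.fourier_eq] at h
    have : ∀ x : E3, Real.fourierChar (-inner ℝ x ξ) • greenIntegrand κ (x, s) =
        (Real.fourierChar (-inner ℝ x ξ) • Complex.exp (-((s ^ 2 / 4 : ℝ) : ℂ) * (‖x‖ : ℂ) ^ 2)) *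
          (Real.exp (-κ ^ 2 / s ^ 2) : ℝ) := by
      intro x
      rw [greenIntegrand, smul_mul_assoc]
    simp_rw [this]
    rw [integral_mul_const, h]
    have e3 : ((Real.pi : ℂ) / ((s ^ 2 / 4 : ℝ) : ℂ)) ^ ((Module.finrank ℝ E3 : ℂ) / 2) =
        ((8 * Real.pi * Real.sqrt Real.pi * (s ^ 3)⁻¹ : ℝ) : ℂ) := by
      rw [← rpow_gauss_const hs', Complex.ofReal_cpow (by positivity)]
      simp
    rw [e3]
    have e4 : Complex.exp (-(Real.pi : ℂ) ^ 2 * (‖ξ‖ : ℂ) ^ 2 / ((s ^ 2 / 4 : ℝ) : ℂ)) =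
        (Real.exp (-((2 * Real.pi) ^ 2 * ‖ξ‖ ^ 2) / s ^ 2) : ℝ) := by
      push_cast
      congr 1
      have : (s : ℂ) ≠ 0 := by exact_mod_cast hs'.ne'
      field_simp
      ring
    rw [e4, ← Complex.ofReal_mul, ← Complex.ofReal_mul]
    congr 1
    rw [mul_assoc, ← Real.exp_add, mul_assoc _ (s ^ 3)⁻¹]
    congr 3
    ring
  rw [e1, integral_const_mul, integral_integral_swap hint, setIntegral_congr_fun measurableSet_Ioi e2,
    integral_complex_ofReal, integral_const_mul, (integral_inv_cube_mul_exp hA).2, hc,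
    ← Complex.ofReal_mul, resolventSymbol]
  have e5 : (2 * Real.pi) ^ 2 * ‖ξ‖ ^ 2 - ((κ : ℂ) * Complex.I) ^ 2 =
      (((2 * Real.pi) ^ 2 * ‖ξ‖ ^ 2 + κ ^ 2 : ℝ) : ℂ) := by
    rw [mul_pow (κ : ℂ), Complex.I_sq]
    push_cast
    ring
  rw [e5, ← Complex.ofReal_inv]
  congr 1
  have hpi : 0 < Real.pi := Real.pi_pos
  field_simp
  norm_num

/-! ### The free resolvent as a convolution -/

theorem ae_eq_of_integral_schwartz_mul_eq {f g : E3 → ℂ} (hf : LocallyIntegrable f)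
    (hg : LocallyIntegrable g) (h : ∀ φ : 𝓢(E3, ℂ), ∫ x, φ x * f x = ∫ x, φ x * g x) :
    f =ᵐ[volume] g := by
  have h0 : ∀ᵐ x, (fun x => f x - g x) x = 0 := by
    apply ae_eq_zero_of_integral_contDiff_smul_eq_zero (hf.sub hg)
    intro φ hφ hc
    have hc₁ : HasCompactSupport (Complex.ofRealCLM ∘ φ) := hc.comp_left rfl
    have hs₁ : ContDiff ℝ ((⊤ : ℕ∞) : WithTop ℕ∞) (Complex.ofRealCLM ∘ φ) := by fun_prop
    have hcont : Continuous fun x => (φ x : ℂ) := Complex.continuous_ofReal.comp hφ.continuous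
    have := h (hc₁.toSchwartzMap hs₁)
    have i1 : Integrable (fun x => (φ x : ℂ) * f x) :=
      hf.integrable_smul_left_of_hasCompactSupport (g := fun x => (φ x : ℂ)) hcont hc₁
    have i2 : Integrable (fun x => (φ x : ℂ) * g x) :=
      hg.integrable_smul_left_of_hasCompactSupport (g := fun x => (φ x : ℂ)) hcont hc₁
    have e : ∀ x, φ x • (f - g) x = (φ x : ℂ) * f x - (φ x : ℂ) * g x := by
      intro x
      rw [Complex.real_smul, Pi.sub_apply]
      ring
    simp_rw [e]
    rw [integral_sub i1 i2, sub_eq_zero]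
    exact this
  filter_upwards [h0] with x hx
  exact sub_eq_zero.1 hx

theorem L2.locallyIntegrable (f : L2) : LocallyIntegrable f :=
  (Lp.memLp f).locallyIntegrable (by norm_num)

open FourierTransform in
theorem integral_schwartz_fourier_mul_L2 (ψ : 𝓢(E3, ℂ)) (w : L2) :
    ∫ x, (𝓕 ψ) x * w x = ∫ x, ψ x * (𝓕 w : L2) x := by
  have := congrArg (fun u : 𝓢'(E3, ℂ) => u ψ) (Lp.fourier_toTemperedDistribution_eq w)
  simpa [TemperedDistribution.fourier_apply] using this

open FourierTransform in
theorem integral_schwartz_fourier_mul (ψ : 𝓢(E3, ℂ)) {f : E3 → ℂ} (hf : Integrable f) :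
    ∫ x, (𝓕 ψ) x * f x = ∫ x, ψ x * 𝓕 f x := by
  rw [SchwartzMap.fourier_coe]
  have := VectorFourier.integral_fourierIntegral_smul_eq_flip (L := innerₗ E3)
      Real.continuous_fourierChar continuous_inner (ψ.integrable (μ := volume)) hf
  rw [flip_innerₗ] at this
  exact this

open FourierTransform in
theorem locallyIntegrable_fourier {f : E3 → ℂ} (hf : Integrable f) :
    LocallyIntegrable (𝓕 f) := by
  have : Continuous (𝓕 f) :=
    VectorFourier.fourierIntegral_continuous Real.continuous_fourierChar
      (by exact continuous_inner) hf
  exact this.locallyIntegrable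

open FourierTransform in
/-- On `L¹ ∩ L²`, the Fourier transform is given by the Fourier integral. -/
theorem fourier_L2_ae_eq {f : L2} (hf : Integrable f) :
    (𝓕 f : L2) =ᵐ[volume] 𝓕 (f : E3 → ℂ) := by
  refine ae_eq_of_integral_schwartz_mul_eq (L2.locallyIntegrable _) (locallyIntegrable_fourier hf)
    fun ψ => ?_
  rw [← integral_schwartz_fourier_mul_L2, ← integral_schwartz_fourier_mul ψ hf]

open FourierTransform in
/-- For `κ > 0`, the free resolvent `(-Δ + κ²)⁻¹` is the convolution with the Green function. -/
theorem freeResolvent_ae_eq_integral {κ : ℝ} (hκ : 0 < κ) {f : L2} (hf : Integrable f) :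
    (freeResolvent (κ * Complex.I) f : E3 → ℂ) =ᵐ[volume]
      fun x => ∫ y, greenFunction κ (x - y) * f y := by
  set u : E3 → ℂ := convolution (greenFunction κ) f (ContinuousLinearMap.lsmul ℂ ℂ) volume with hu
  have hueq : u = fun x => ∫ y, greenFunction κ (x - y) * f y := by
    ext x
    exact convolution_lsmul_swap
  have hui : Integrable u := (integrable_greenFunction hκ).integrable_convolution _ hf
  have hF : ∀ ξ, 𝓕 u ξ = resolventSymbol (κ * Complex.I) ξ * 𝓕 (f : E3 → ℂ) ξ := by
    intro ξ
    rw [hu, Real.fourier_smul_convolution_eq (integrable_greenFunction hκ) hf,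
      fourier_greenFunction hκ, smul_eq_mul]
  rw [← hueq]
  refine ae_eq_of_integral_schwartz_mul_eq (L2.locallyIntegrable _) hui.locallyIntegrable
    fun φ => ?_
  -- Every Schwartz function is a Fourier transform, so the pairing moves to the frequency side,
  -- where both candidates are the symbol times the transform of `f`.
  obtain ⟨ψ, rfl⟩ : ∃ ψ : 𝓢(E3, ℂ), 𝓕 ψ = φ := ⟨𝓕⁻ φ, FourierTransform.fourier_fourierInv_eq φ⟩
  rw [integral_schwartz_fourier_mul_L2, integral_schwartz_fourier_mul ψ hui]
  apply integral_congr_ae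
  have hz : 0 < ((κ : ℂ) * Complex.I).im := by simpa using hκ
  filter_upwards [fourier_freeResolvent hz f, fourier_L2_ae_eq hf] with ξ h1 h2
  rw [h1, h2, hF]

/-! ### Convolution operators with radial kernels from `L²_comp` to `L²_loc` -/

/-- The truncated Coulomb kernel `1_{|y| < d} |y|⁻¹`. -/
def coulomb (d : ℝ) (y : E3) : ℝ := (Metric.ball (0 : E3) d).indicator (fun y => ‖y‖⁻¹) y

theorem aestronglyMeasurable_coulomb (d : ℝ) :
    AEStronglyMeasurable (coulomb d) (volume : Measure E3) := by
  refine (Measurable.indicator ?_ measurableSet_ball).aestronglyMeasurable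
  fun_prop

theorem memLp_coulomb (d : ℝ) : MemLp (coulomb d) 2 (volume : Measure E3) := by
  rw [memLp_two_iff_integrable_sq (aestronglyMeasurable_coulomb d)]
  have h : IntegrableOn (fun y : E3 => ‖y‖⁻¹ ^ 2) (Metric.ball 0 d) := by
    -- The squared kernel has exponent `2`, below the dimension `3`.
    refine integrableOn_ball_of_norm_le_rpow (C := 1) (α := 2) (by simp) (by simp; norm_num)
      (ae_of_all _ fun y => ?_) (Measurable.aestronglyMeasurable (by fun_prop))
    rw [Real.rpow_neg (norm_nonneg _), one_mul]
    simp
  rw [← integrable_indicator_iff measurableSet_ball] at h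
  refine h.congr (ae_of_all _ fun y => ?_)
  by_cases hy : y ∈ Metric.ball (0 : E3) d
  · simp [coulomb, indicator_of_mem hy]
  · simp [coulomb, indicator_of_notMem hy]

/-- The `L²` norm of the truncated Coulomb kernel. -/
def coulombNorm (d : ℝ) : ℝ := (eLpNorm (coulomb d) 2 volume).toReal

/-- The kernel `φ(|x - y|) / |x - y|`. -/
def radialKernel (φ : C(ℝ, ℂ)) (x y : E3) : ℂ := φ ‖x - y‖ / (‖x - y‖ : ℝ)

theorem measurable_radialKernel (φ : C(ℝ, ℂ)) :
    Measurable fun p : E3 × E3 => radialKernel φ p.1 p.2 := by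
  unfold radialKernel
  have h : Measurable fun p : E3 × E3 => φ ‖p.1 - p.2‖ :=
    (φ.continuous.comp (by fun_prop : Continuous fun p : E3 × E3 => ‖p.1 - p.2‖)).measurable
  exact h.div (Complex.measurable_ofReal.comp (by fun_prop))

theorem measurable_radialKernel_right (φ : C(ℝ, ℂ)) (x : E3) : Measurable (radialKernel φ x) := by
  have h := (measurable_radialKernel φ).comp (measurable_prodMk_left (x := x) (β := E3))
  exact h

/-- On `L` the kernel is dominated by `M` times the Coulomb kernel at `x - y`, whose norm does not
depend on `x` by invariance of the measure. The uniformity in `x` is what later makes truncations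
Hilbert-Schmidt. -/
theorem eLpNorm_indicator_radialKernel_le {φ : C(ℝ, ℂ)} {M d : ℝ}
    (hM : ∀ r ∈ Icc 0 d, ‖φ r‖ ≤ M) {L : Set E3} {x : E3}
    (hd : ∀ y ∈ L, ‖x - y‖ < d) :
    eLpNorm (L.indicator (radialKernel φ x)) 2 volume ≤ ENNReal.ofReal M *
      eLpNorm (coulomb d) 2 volume := by
  rw [← eLpNorm_comp_measurePreserving (aestronglyMeasurable_coulomb d)
    (Measure.measurePreserving_sub_left volume x)]
  refine eLpNorm_le_mul_eLpNorm_of_ae_le_mul (ae_of_all _ fun y => ?_) 2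
  by_cases hy : y ∈ L
  · rw [indicator_of_mem hy, Function.comp_apply, coulomb,
      indicator_of_mem (by simpa using hd y hy), radialKernel, norm_div, norm_inv, norm_norm,
      Complex.norm_real, norm_norm, div_eq_mul_inv]
    gcongr
    exact hM _ ⟨norm_nonneg _, (hd y hy).le⟩
  · rw [indicator_of_notMem hy, norm_zero, Function.comp_apply, coulomb]
    by_cases h : x - y ∈ Metric.ball (0 : E3) d
    · rw [indicator_of_mem h, norm_inv, norm_norm]
      have h' : ‖x - y‖ < d := by simpa using h
      have := (norm_nonneg _).trans (hM _ ⟨norm_nonneg _, h'.le⟩)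
      positivity
    · simp [indicator_of_notMem h]

theorem exists_forall_norm_sub_lt {K L : Set E3} (hK : IsCompact K) (hL : IsCompact L) :
    ∃ d : ℝ, 0 ≤ d ∧ ∀ x ∈ K, ∀ y ∈ L, ‖x - y‖ < d := by
  obtain ⟨a, ha⟩ := hK.isBounded.exists_norm_le
  obtain ⟨b, hb⟩ := hL.isBounded.exists_norm_le
  refine ⟨|a| + |b| + 1, by positivity, fun x hx y hy => ?_⟩
  have h1 := norm_sub_le x y
  have h2 := ha x hx
  have h3 := hb y hy
  have h4 := le_abs_self a
  have h5 := le_abs_self b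
  linarith

theorem exists_forall_norm_le_Icc (φ : C(ℝ, ℂ)) (d : ℝ) :
    ∃ M, ∀ r ∈ Icc 0 d, ‖φ r‖ ≤ M :=
  isCompact_Icc.exists_bound_of_continuousOn φ.continuous.continuousOn

/-- The conjugate compensates for the conjugate linearity of the inner product in its first
argument. -/
theorem memLp_indicator_radialKernel (φ : C(ℝ, ℂ)) (L : TopologicalSpace.Compacts E3) (x : E3) :
    MemLp ((L : Set E3).indicator (fun y => (starRingEnd ℂ) (radialKernel φ x y))) 2 volume := by
  obtain ⟨d, -, hd⟩ := exists_forall_norm_sub_lt (isCompact_singleton (x := x)) L.isCompact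
  obtain ⟨M, hM⟩ := exists_forall_norm_le_Icc φ d
  have h : MemLp ((L : Set E3).indicator (radialKernel φ x)) 2 volume := by
    refine ⟨((measurable_radialKernel_right φ x).indicator
      L.isCompact.measurableSet).aestronglyMeasurable, ?_⟩
    refine (eLpNorm_indicator_radialKernel_le hM (hd x rfl)).trans_lt ?_
    exact ENNReal.mul_lt_top ENNReal.ofReal_lt_top (memLp_coulomb d).2
  have h2 := h.star
  convert h2 using 1
  ext y
  by_cases hy : y ∈ (L : Set E3) <;> simp [hy]

/-- The element `y ↦ 1_L(y) conj (φ(|x - y|) / |x - y|)` of `L²`. -/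
def kernelVec (φ : C(ℝ, ℂ)) (L : TopologicalSpace.Compacts E3) (x : E3) : L2 :=
  (memLp_indicator_radialKernel φ L x).toLp _

theorem norm_kernelVec_le {φ : C(ℝ, ℂ)} {M d : ℝ} (hM0 : 0 ≤ M)
    (hM : ∀ r ∈ Icc 0 d, ‖φ r‖ ≤ M) {L : TopologicalSpace.Compacts E3} {x : E3}
    (hd : ∀ y ∈ L, ‖x - y‖ < d) : ‖kernelVec φ L x‖ ≤ M * coulombNorm d := by
  rw [kernelVec, Lp.norm_toLp]
  have h := eLpNorm_indicator_radialKernel_le hM (L := L) hd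
  have e : eLpNorm ((L : Set E3).indicator (fun y => (starRingEnd ℂ) (radialKernel φ x y))) 2 volume
      = eLpNorm ((L : Set E3).indicator (radialKernel φ x)) 2 volume := by
    apply eLpNorm_congr_norm_ae (ae_of_all _ fun y => ?_)
    by_cases hy : y ∈ (L : Set E3) <;> simp [hy]
  rw [e]
  refine (ENNReal.toReal_mono ?_ h).trans ?_
  · exact (ENNReal.mul_lt_top ENNReal.ofReal_lt_top (memLp_coulomb d).2).ne
  · rw [ENNReal.toReal_mul, ENNReal.toReal_ofReal hM0, coulombNorm]

theorem inner_kernelVec_ae (φ : C(ℝ, ℂ)) {L : TopologicalSpace.Compacts E3} (x : E3) {f : L2}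
    (hf : ∀ᵐ y, y ∉ L → f y = 0) :
    (fun y => inner ℂ (kernelVec φ L x y) (f y)) =ᵐ[volume] fun y => radialKernel φ x y * f y := by
  filter_upwards [hf, (memLp_indicator_radialKernel φ L x).coeFn_toLp] with y h1 h2
  rw [kernelVec, h2]
  by_cases hy : y ∈ (L : Set E3)
  · rw [indicator_of_mem hy]
    simp [mul_comm]
  · rw [indicator_of_notMem hy, h1 hy]
    simp

/-- The convolution with the radial function `φ(|x|) / |x|`. -/
def radialConv (φ : C(ℝ, ℂ)) (f : E3 → ℂ) (x : E3) : ℂ := ∫ y, radialKernel φ x y * f y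

theorem radialConv_eq_inner (φ : C(ℝ, ℂ)) {L : TopologicalSpace.Compacts E3} (x : E3) {f : L2}
    (hf : ∀ᵐ y, y ∉ L → f y = 0) : radialConv φ f x = inner ℂ (kernelVec φ L x) f := by
  rw [L2.inner_def, integral_congr_ae (inner_kernelVec_ae φ x hf), radialConv]

theorem integrable_radialKernel_mul (φ : C(ℝ, ℂ)) (f : L2Comp) (x : E3) :
    Integrable (fun y => radialKernel φ x y * (f : L2) y) := by
  obtain ⟨L, hL, hf⟩ := f.2
  exact (L2.integrable_inner (𝕜 := ℂ) (kernelVec φ ⟨L, hL⟩ x) (f : L2)).congr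
    (inner_kernelVec_ae φ (L := ⟨L, hL⟩) x hf)

theorem measurable_radialConv (φ : C(ℝ, ℂ)) (f : L2) :
    AEStronglyMeasurable (radialConv φ f) volume := by
  refine AEStronglyMeasurable.integral_prod_right'
    (f := fun p : E3 × E3 => radialKernel φ p.1 p.2 * f p.2) ?_
  exact (measurable_radialKernel φ).aestronglyMeasurable.mul
    ((Lp.stronglyMeasurable f).comp_measurable measurable_snd).aestronglyMeasurable

theorem norm_radialConv_le {φ : C(ℝ, ℂ)} {M d : ℝ} (hM0 : 0 ≤ M)
    (hM : ∀ r ∈ Icc 0 d, ‖φ r‖ ≤ M) {L : TopologicalSpace.Compacts E3} {x : E3}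
    (hd : ∀ y ∈ L, ‖x - y‖ < d) {f : L2} (hf : ∀ᵐ y, y ∉ L → f y = 0) :
    ‖radialConv φ f x‖ ≤ M * coulombNorm d * ‖f‖ := by
  rw [radialConv_eq_inner φ x hf]
  refine (norm_inner_le_norm _ _).trans ?_
  gcongr
  exact norm_kernelVec_le hM0 hM hd

theorem memLp_radialConv (φ : C(ℝ, ℂ)) (f : L2Comp) {K : Set E3} (hK : IsCompact K) :
    MemLp (radialConv φ (f : L2)) 2 (volume.restrict K) := by
  obtain ⟨L, hL, hf⟩ := f.2
  obtain ⟨d, hd0, hd⟩ := exists_forall_norm_sub_lt hK hL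
  obtain ⟨M, hM⟩ := exists_forall_norm_le_Icc φ d
  have hM0 : 0 ≤ M := (norm_nonneg _).trans (hM 0 ⟨le_rfl, hd0⟩)
  have : IsFiniteMeasure (volume.restrict K) := ⟨by simpa using hK.measure_lt_top⟩
  refine MemLp.of_bound (measurable_radialConv φ f).restrict (M * coulombNorm d * ‖(f : L2)‖) ?_
  filter_upwards [ae_restrict_mem hK.measurableSet] with x hx
  exact norm_radialConv_le hM0 hM (L := ⟨L, hL⟩) (hd x hx) hf

theorem L2Loc.ext {f g : L2Loc} (h : (f.toAEEqFun : E3 → ℂ) =ᵐ[volume] g.toAEEqFun) : f = g :=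
  Subtype.ext (AEEqFun.ext h)

/-- The convolution operator with kernel `φ(|x - y|) / |x - y|`, from `L²_comp` to `L²_loc`. -/
def radialOpFun (φ : C(ℝ, ℂ)) (f : L2Comp) : L2Loc :=
  ⟨AEEqFun.mk (radialConv φ (f : L2)) (measurable_radialConv φ f), fun _ hK =>
    (memLp_congr_ae (ae_restrict_of_ae (AEEqFun.coeFn_mk _ _))).2 (memLp_radialConv φ f hK)⟩

theorem coeFn_radialOpFun (φ : C(ℝ, ℂ)) (f : L2Comp) :
    ((radialOpFun φ f).toAEEqFun : E3 → ℂ) =ᵐ[volume] radialConv φ (f : L2) :=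
  AEEqFun.coeFn_mk _ _

theorem L2Loc.coeFn_add (f g : L2Loc) :
    ((f + g).toAEEqFun : E3 → ℂ) =ᵐ[volume] fun x => f.toAEEqFun x + g.toAEEqFun x :=
  AEEqFun.coeFn_add _ _

theorem L2Loc.coeFn_smul (c : ℂ) (f : L2Loc) :
    ((c • f).toAEEqFun : E3 → ℂ) =ᵐ[volume] fun x => c * f.toAEEqFun x :=
  AEEqFun.coeFn_smul _ _

/-- The convolution operators with kernel `φ(|x - y|) / |x - y|`, linear in `φ`. -/
def radialOp : C(ℝ, ℂ) →ₗ[ℂ] L2Comp →ₗ[ℂ] L2Loc :=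
  LinearMap.mk₂ ℂ radialOpFun
    (by
      intro φ ψ f
      apply L2Loc.ext
      filter_upwards [coeFn_radialOpFun (φ + ψ) f, coeFn_radialOpFun φ f, coeFn_radialOpFun ψ f,
        L2Loc.coeFn_add (radialOpFun φ f) (radialOpFun ψ f)] with x h1 h2 h3 h4
      rw [h1, h4, h2, h3]
      unfold radialConv
      rw [← integral_add (integrable_radialKernel_mul φ f x) (integrable_radialKernel_mul ψ f x)]
      congr 1
      ext y
      simp only [radialKernel, ContinuousMap.add_apply]
      ring)
    (by
      intro c φ f
      apply L2Loc.ext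
      filter_upwards [coeFn_radialOpFun (c • φ) f, coeFn_radialOpFun φ f,
        L2Loc.coeFn_smul c (radialOpFun φ f)] with x h1 h2 h3
      rw [h1, h3, h2]
      unfold radialConv
      rw [← integral_const_mul]
      congr 1
      ext y
      simp only [radialKernel, ContinuousMap.smul_apply, smul_eq_mul]
      ring)
    (by
      intro φ f g
      apply L2Loc.ext
      filter_upwards [coeFn_radialOpFun φ (f + g), coeFn_radialOpFun φ f, coeFn_radialOpFun φ g,
        L2Loc.coeFn_add (radialOpFun φ f) (radialOpFun φ g)] with x h1 h2 h3 h4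
      rw [h1, h4, h2, h3]
      unfold radialConv
      rw [← integral_add (integrable_radialKernel_mul φ f x) (integrable_radialKernel_mul φ g x)]
      apply integral_congr_ae
      filter_upwards [Lp.coeFn_add (f : L2) (g : L2)] with y hy
      rw [Submodule.coe_add, hy, Pi.add_apply]
      ring)
    (by
      intro c φ f
      apply L2Loc.ext
      filter_upwards [coeFn_radialOpFun φ (c • f), coeFn_radialOpFun φ f,
        L2Loc.coeFn_smul c (radialOpFun φ f)] with x h1 h2 h3
      rw [h1, h3, h2]
      unfold radialConv
      rw [← integral_const_mul]
      apply integral_congr_ae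
      filter_upwards [Lp.coeFn_smul c (f : L2)] with y hy
      rw [Submodule.coe_smul, hy, Pi.smul_apply, smul_eq_mul]
      ring)

theorem coeFn_radialOp (φ : C(ℝ, ℂ)) (f : L2Comp) :
    ((radialOp φ f).toAEEqFun : E3 → ℂ) =ᵐ[volume] radialConv φ (f : L2) :=
  coeFn_radialOpFun φ f

theorem coeFn_cutLoc (K : TopologicalSpace.Compacts E3) (f : L2Loc) :
    (cutLoc K f : E3 → ℂ) =ᵐ[volume] (K : Set E3).indicator f.toAEEqFun :=
  (L2Loc.memLp_indicator K f).coeFn_toLp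

theorem coeFn_cutComp (K : TopologicalSpace.Compacts E3) (f : L2) :
    ((cutComp K f : L2) : E3 → ℂ) =ᵐ[volume] (K : Set E3).indicator f :=
  ((Lp.memLp f).indicator K.isCompact.measurableSet).coeFn_toLp

/-- The indicator of `L` already sits inside `kernelVec`, so cutting off `f` changes nothing. As an
inner product, the truncation is accessible to Cauchy-Schwarz and to Bessel's inequality. -/
theorem coeFn_truncation_radialOp (φ : C(ℝ, ℂ)) (K L : TopologicalSpace.Compacts E3) (f : L2) :
    (truncation K L (radialOp φ) f : E3 → ℂ) =ᵐ[volume]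
      (K : Set E3).indicator (fun x => inner ℂ (kernelVec φ L x) f) := by
  have hsupp : ∀ᵐ y, y ∉ L → (cutComp L f : L2) y = 0 := by
    filter_upwards [coeFn_cutComp L f] with y hy h
    rw [hy]
    exact indicator_of_notMem h _
  filter_upwards [coeFn_cutLoc K (radialOp φ (cutComp L f)), coeFn_radialOp φ (cutComp L f)]
    with x h1 h2
  have : truncation K L (radialOp φ) f = cutLoc K (radialOp φ (cutComp L f)) := rfl
  rw [this, h1]
  by_cases hx : x ∈ (K : Set E3)
  · rw [indicator_of_mem hx, indicator_of_mem hx, h2, radialConv_eq_inner φ x hsupp, L2.inner_def,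
      L2.inner_def]
    apply integral_congr_ae
    filter_upwards [coeFn_cutComp L f, (memLp_indicator_radialKernel φ L x).coeFn_toLp] with y h3 h4
    rw [kernelVec, h3, h4]
    by_cases hy : y ∈ (L : Set E3)
    · rw [indicator_of_mem hy, indicator_of_mem hy]
    · simp [indicator_of_notMem hy]
  · rw [indicator_of_notMem hx, indicator_of_notMem hx]

theorem norm_le_of_ae_indicator {K : Set E3} (hK : IsCompact K) {g : L2} {c : ℝ} (hc : 0 ≤ c)
    (h : ∀ᵐ x, ‖g x‖ ≤ K.indicator (fun _ => c) x) :
    ‖g‖ ≤ c * Real.sqrt (volume.real K) := by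
  have h1 : ‖g‖ ≤ ‖indicatorConstLp 2 hK.measurableSet
      (hK.measure_lt_top (μ := volume)).ne (c : ℂ)‖ := by
    apply Lp.norm_le_norm_of_ae_le
    filter_upwards [h, indicatorConstLp_coeFn (p := 2) (hs := hK.measurableSet)
      (hμs := hK.measure_lt_top.ne) (c := (c : ℂ))] with x h1 h2
    rw [h2]
    refine h1.trans (le_of_eq ?_)
    by_cases hx : x ∈ K
    · simp [hx, abs_of_nonneg hc]
    · simp [hx]
  refine h1.trans (le_of_eq ?_)
  rw [norm_indicatorConstLp (by norm_num) (by norm_num), Complex.norm_real, Real.norm_eq_abs,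
    abs_of_nonneg hc, Real.sqrt_eq_rpow]
  simp

/-- Cauchy-Schwarz bounds the output pointwise by a constant on `K`. Only the values of `φ` on `[0,
d]` enter, which is why holomorphy of `φ` on compact intervals suffices. -/
theorem norm_truncation_radialOp_le {K L : TopologicalSpace.Compacts E3} {d M : ℝ}
    (hd : ∀ x ∈ K, ∀ y ∈ L, ‖x - y‖ < d) {φ : C(ℝ, ℂ)} (hM0 : 0 ≤ M)
    (hM : ∀ r ∈ Icc 0 d, ‖φ r‖ ≤ M) (f : L2) :
    ‖truncation K L (radialOp φ) f‖ ≤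
      coulombNorm d * Real.sqrt (volume.real (K : Set E3)) * M * ‖f‖ := by
  have h0 : 0 ≤ coulombNorm d := ENNReal.toReal_nonneg
  refine (norm_le_of_ae_indicator K.isCompact (c := M * coulombNorm d * ‖f‖) (by positivity)
    ?_).trans (le_of_eq (by ring))
  filter_upwards [coeFn_truncation_radialOp φ K L f] with x hx
  rw [hx]
  by_cases h : x ∈ (K : Set E3)
  · rw [indicator_of_mem h, indicator_of_mem h]
    refine (norm_inner_le_norm _ _).trans ?_
    gcongr
    exact norm_kernelVec_le hM0 hM (hd x h)
  · rw [indicator_of_notMem h, indicator_of_notMem h, norm_zero]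

theorem truncation_add (K L : TopologicalSpace.Compacts E3) (A B : L2Comp →ₗ[ℂ] L2Loc) :
    truncation K L (A + B) = truncation K L A + truncation K L B := by
  ext1 f
  simp [truncation]

theorem truncation_smul (K L : TopologicalSpace.Compacts E3) (c : ℂ) (A : L2Comp →ₗ[ℂ] L2Loc) :
    truncation K L (c • A) = c • truncation K L A := by
  ext1 f
  simp [truncation]

/-- The extension of a continuous function on `[0, d]` to a function on `ℝ`, constant on both
half lines. -/
def extendIcc {d : ℝ} (hd : 0 ≤ d) (ψ : C(Icc 0 d, ℂ)) : C(ℝ, ℂ) :=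
  ψ.comp ⟨projIcc 0 d hd, continuous_projIcc⟩

theorem extendIcc_add {d : ℝ} (hd : 0 ≤ d) (ψ₁ ψ₂ : C(Icc 0 d, ℂ)) :
    extendIcc hd (ψ₁ + ψ₂) = extendIcc hd ψ₁ + extendIcc hd ψ₂ := rfl

theorem extendIcc_smul {d : ℝ} (hd : 0 ≤ d) (c : ℂ) (ψ : C(Icc 0 d, ℂ)) :
    extendIcc hd (c • ψ) = c • extendIcc hd ψ := rfl

/-- The truncations of a radial convolution operator depend continuously on the restriction of the
radial function to a compact interval. -/
theorem exists_truncation_radialOp (K L : TopologicalSpace.Compacts E3) :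
    ∃ (d : ℝ) (τ : C(Icc 0 d, ℂ) →L[ℂ] L2 →L[ℂ] L2), ∀ (φ : C(ℝ, ℂ)) (f : L2),
      τ (φ.restrict (Icc 0 d)) f = truncation K L (radialOp φ) f := by
  obtain ⟨d, hd0, hd⟩ := exists_forall_norm_sub_lt K.isCompact L.isCompact
  set C : ℝ := coulombNorm d * Real.sqrt (volume.real (K : Set E3)) with hC
  have hC0 : 0 ≤ C := mul_nonneg ENNReal.toReal_nonneg (Real.sqrt_nonneg _)
  have hbound : ∀ (ψ : C(Icc 0 d, ℂ)) (f : L2),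
      ‖truncation K L (radialOp (extendIcc hd0 ψ)) f‖ ≤ C * ‖ψ‖ * ‖f‖ := fun ψ f =>
    norm_truncation_radialOp_le hd (norm_nonneg ψ) (fun r _ => ψ.norm_coe_le_norm _) f
  refine ⟨d, LinearMap.mkContinuous₂ (LinearMap.mk₂ ℂ
    (fun (ψ : C(Icc 0 d, ℂ)) (f : L2) => truncation K L (radialOp (extendIcc hd0 ψ)) f)
    ?_ ?_ ?_ ?_) C hbound, fun φ f => ?_⟩
  · intro ψ₁ ψ₂ f
    rw [extendIcc_add, map_add, truncation_add, LinearMap.add_apply]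
  · intro c ψ f
    rw [extendIcc_smul, map_smul, truncation_smul, LinearMap.smul_apply]
  · intro ψ f g
    exact map_add _ _ _
  · intro c ψ f
    exact map_smul _ _ _
  · change truncation K L (radialOp (extendIcc hd0 (φ.restrict (Icc 0 d)))) f = _
    -- The bound with `M = 0`: a radial function vanishing on `[0, d]` has zero truncation, so the
    -- extension chosen outside `[0, d]` is irrelevant.
    have h := norm_truncation_radialOp_le hd (M := 0) le_rfl
      (φ := extendIcc hd0 (φ.restrict (Icc 0 d)) - φ) ?_ f
    · rw [map_sub, sub_eq_add_neg, ← neg_one_smul ℂ (radialOp φ), truncation_add, truncation_smul,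
        mul_zero, zero_mul, norm_le_zero_iff] at h
      simp only [LinearMap.add_apply, neg_smul, one_smul] at h
      exact eq_of_sub_eq_zero (by rw [sub_eq_add_neg]; exact h)
    · intro r hr
      simp [extendIcc, projIcc_of_mem hd0 hr]

/-! ### Norm limits of finite rank operators -/

/-- A bounded operator that is a norm limit of operators factoring through some `ℂⁿ`. -/
def IsFiniteRankLimit {H : Type*} [NormedAddCommGroup H] [NormedSpace ℂ H] (B : H →L[ℂ] H) : Prop :=
  ∀ ε : ℝ, 0 < ε → ∃ (n : ℕ) (i : (Fin n → ℂ) →L[ℂ] H) (p : H →L[ℂ] (Fin n → ℂ)),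
    ‖B - i ∘L p‖ < ε

theorem IsFiniteRankLimit.comp_left {H : Type*} [NormedAddCommGroup H] [NormedSpace ℂ H]
    {B : H →L[ℂ] H} (hB : IsFiniteRankLimit B) (A : H →L[ℂ] H) : IsFiniteRankLimit (A ∘L B) := by
  intro ε hε
  obtain ⟨n, i, p, h⟩ := hB (ε / (‖A‖ + 1)) (by positivity)
  refine ⟨n, A ∘L i, p, ?_⟩
  have e : A ∘L B - (A ∘L i) ∘L p = A ∘L (B - i ∘L p) := by
    ext f
    simp
  rw [e]
  calc ‖A ∘L (B - i ∘L p)‖ ≤ ‖A‖ * ‖B - i ∘L p‖ := ContinuousLinearMap.opNorm_comp_le _ _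
    _ ≤ ‖A‖ * (ε / (‖A‖ + 1)) := by gcongr
    _ < (‖A‖ + 1) * (ε / (‖A‖ + 1)) := by gcongr; linarith
    _ = ε := by field_simp

/-- The operator `f ↦ ∑_{i ∈ s} ⟪b i, f⟫ B (b i)`, factored through `ℂⁿ`. -/
theorem exists_factor_sum_inner_smul {H ι : Type*} [NormedAddCommGroup H] [InnerProductSpace ℂ H]
    (s : Finset ι) (b v : ι → H) : ∃ (n : ℕ) (i : (Fin n → ℂ) →L[ℂ] H) (p : H →L[ℂ] (Fin n → ℂ)),
      ∀ f, i (p f) = ∑ j ∈ s, inner ℂ (b j) f • v j := by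
  refine ⟨s.card, ∑ j : Fin s.card, (ContinuousLinearMap.proj j : (Fin s.card → ℂ) →L[ℂ] ℂ).smulRight
    (v (s.equivFin.symm j)), ContinuousLinearMap.pi fun j => innerSL ℂ (b (s.equivFin.symm j)),
    fun f => ?_⟩
  rw [← s.sum_coe_sort, ← s.equivFin.symm.sum_comp]
  simp

/-- The Hilbert-Schmidt criterion: if `∑_{i ∈ s} ‖B (b i)‖²` is bounded independently of `s` for
a Hilbert basis `b`, then `B` is a norm limit of finite rank operators. -/
theorem isFiniteRankLimit_of_sum_sq_le {H : Type*} [NormedAddCommGroup H] [InnerProductSpace ℂ H]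
    [CompleteSpace H] (B : H →L[ℂ] H) {C : ℝ}
    (hB : ∀ (w : Set H) (b : HilbertBasis w ℂ H) (s : Finset w), ∑ i ∈ s, ‖B (b i)‖ ^ 2 ≤ C) :
    IsFiniteRankLimit B := by
  classical
  intro ε hε
  obtain ⟨w, b, -⟩ := exists_hilbertBasis ℂ H
  have hsum : Summable fun i => ‖B (b i)‖ ^ 2 :=
    summable_of_sum_le (fun i => sq_nonneg _) (hB w b)
  -- Cauchy-Schwarz will take the square root of the tail, hence `(ε/2)²`; the margin `ε/2 < ε`
  -- absorbs the loss of strictness in the limit.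
  obtain ⟨s, hs⟩ := summable_iff_vanishing_norm.1 hsum ((ε / 2) ^ 2) (by positivity)
  obtain ⟨n, i, p, hip⟩ := exists_factor_sum_inner_smul s b (fun i => B (b i))
  refine ⟨n, i, p, lt_of_le_of_lt ?_ (half_lt_self hε)⟩
  refine ContinuousLinearMap.opNorm_le_bound _ (by positivity) fun f => ?_
  have hlim : Filter.Tendsto (fun t : Finset w => ∑ j ∈ t, inner ℂ (b j) f • B (b j) -
      ∑ j ∈ s, inner ℂ (b j) f • B (b j)) Filter.atTop (nhds (B f - i (p f))) := by
    rw [hip]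
    refine Filter.Tendsto.sub_const ?_ _
    have h1 : HasSum (fun j => inner ℂ (b j) f • B (b j)) (B f) := by
      have h2 := (b.hasSum_repr f).mapL B
      simpa [b.repr_apply_apply] using h2
    exact h1
  have hle : ∀ᶠ t : Finset w in Filter.atTop, ‖∑ j ∈ t, inner ℂ (b j) f • B (b j) -
      ∑ j ∈ s, inner ℂ (b j) f • B (b j)‖ ≤ ε / 2 * ‖f‖ := by
    filter_upwards [Filter.eventually_ge_atTop s] with t ht
    rw [← Finset.sum_sdiff ht, add_sub_cancel_right]
    calc ‖∑ j ∈ t \ s, inner ℂ (b j) f • B (b j)‖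
        ≤ ∑ j ∈ t \ s, ‖(inner ℂ (b j) f : ℂ)‖ * ‖B (b j)‖ := by
          refine (norm_sum_le _ _).trans (le_of_eq ?_)
          simp_rw [norm_smul]
      _ ≤ Real.sqrt (∑ j ∈ t \ s, ‖(inner ℂ (b j) f : ℂ)‖ ^ 2) *
          Real.sqrt (∑ j ∈ t \ s, ‖B (b j)‖ ^ 2) := Real.sum_mul_le_sqrt_mul_sqrt _ _ _
      _ ≤ ‖f‖ * (ε / 2) := by
          gcongr
          · rw [Real.sqrt_le_left (norm_nonneg _)]
            exact b.orthonormal.sum_inner_products_le f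
          · rw [Real.sqrt_le_left (by positivity)]
            refine (le_abs_self _).trans (hs (t \ s) Finset.sdiff_disjoint).le
      _ = ε / 2 * ‖f‖ := mul_comm _ _
  exact le_of_tendsto hlim.norm hle

/-- An integral operator on `L²`, with target cut off to a compact set `K` and kernel bounded in
`L²` uniformly over `K`, is a norm limit of finite rank operators. -/
theorem isFiniteRankLimit_of_kernel {K : Set E3} (hK : IsCompact K) {k : E3 → L2} {C : ℝ}
    (hk : ∀ x ∈ K, ‖k x‖ ≤ C) (B : L2 →L[ℂ] L2)
    (hB : ∀ f : L2, (B f : E3 → ℂ) =ᵐ[volume] K.indicator (fun x => inner ℂ (k x) f)) :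
    IsFiniteRankLimit B := by
  refine isFiniteRankLimit_of_sum_sq_le B (C := C ^ 2 * volume.real K) fun w b s => ?_
  have hsq : ∀ g : L2, ‖g‖ ^ 2 = ∫ x, ‖g x‖ ^ 2 := by
    intro g
    have h := L2.inner_def (𝕜 := ℂ) g g
    rw [inner_self_eq_norm_sq_to_K] at h
    have e : ∀ x, (inner ℂ (g x) (g x) : ℂ) = ((‖g x‖ ^ 2 : ℝ) : ℂ) := by
      intro x
      rw [inner_self_eq_norm_sq_to_K]
      simp
    simp_rw [e] at h
    rw [integral_complex_ofReal] at h
    refine Complex.ofReal_injective (Eq.trans ?_ h)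
    push_cast
    rfl
  have hint : ∀ g : L2, Integrable (fun x => ‖g x‖ ^ 2) := fun g =>
    (memLp_two_iff_integrable_sq_norm (Lp.aestronglyMeasurable g)).1 (Lp.memLp g)
  simp_rw [hsq]
  rw [← integral_finsetSum _ fun i _ => hint _]
  have hconst : ∫ x, K.indicator (fun _ => C ^ 2) x = C ^ 2 * volume.real K := by
    rw [integral_indicator hK.measurableSet, setIntegral_const, smul_eq_mul, mul_comm]
  rw [← hconst]
  have hae : ∀ᵐ x, ∀ i ∈ s, B (b i) x = K.indicator (fun x => inner ℂ (k x) (b i)) x := by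
    rw [Filter.eventually_all_finset]
    exact fun i _ => hB (b i)
  refine integral_mono_ae (integrable_finsetSum _ fun i _ => hint _) ?_ ?_
  · exact (integrableOn_const hK.measure_lt_top.ne).integrable_indicator hK.measurableSet
  · filter_upwards [hae] with x hx
    rw [Finset.sum_congr rfl fun i hi => by rw [hx i hi]]
    by_cases h : x ∈ K
    · simp only [indicator_of_mem h]
      -- Bessel's inequality at the fixed point `x` bounds the sum by `‖k x‖² ≤ C²`; integration
      -- over `K` then gives a bound independent of `s`.
      have h1 := b.orthonormal.sum_inner_products_le (k x) (s := s)
      simp_rw [norm_inner_symm (k x)]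
      refine h1.trans ?_
      have := hk x h
      gcongr
    · simp [indicator_of_notMem h]

theorem isFiniteRankLimit_of_eq_truncation_radialOp {K L : TopologicalSpace.Compacts E3}
    {φ : C(ℝ, ℂ)} {B : L2 →L[ℂ] L2} (hB : ∀ f, B f = truncation K L (radialOp φ) f) :
    IsFiniteRankLimit B := by
  obtain ⟨d, hd0, hd⟩ := exists_forall_norm_sub_lt K.isCompact L.isCompact
  obtain ⟨M, hM⟩ := exists_forall_norm_le_Icc φ d
  have hM0 : 0 ≤ M := (norm_nonneg _).trans (hM 0 ⟨le_rfl, hd0⟩)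
  refine isFiniteRankLimit_of_kernel K.isCompact (k := kernelVec φ L) (C := M * coulombNorm d)
    (fun x hx => norm_kernelVec_le hM0 hM (hd x hx)) B fun f => ?_
  rw [hB]
  exact coeFn_truncation_radialOp φ K L f

/-! ### Analytic Fredholm theory -/

section Fredholm

theorem DifferentiableOn.matrix_det {n : ℕ} {U : Set ℂ} {A : ℂ → Matrix (Fin n) (Fin n) ℂ}
    (hA : ∀ j k, DifferentiableOn ℂ (fun z => A z j k) U) :
    DifferentiableOn ℂ (fun z => (A z).det) U := by
  simp_rw [Matrix.det_apply']
  refine DifferentiableOn.fun_sum fun σ _ => DifferentiableOn.const_mul ?_ _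
  exact DifferentiableOn.fun_finsetProd fun j _ => hA _ _

theorem DifferentiableOn.matrix_adjugate {n : ℕ} {U : Set ℂ} {A : ℂ → Matrix (Fin n) (Fin n) ℂ}
    (hA : ∀ j k, DifferentiableOn ℂ (fun z => A z j k) U) (j k : Fin n) :
    DifferentiableOn ℂ (fun z => (A z).adjugate j k) U := by
  simp_rw [Matrix.adjugate_apply]
  refine DifferentiableOn.matrix_det fun a b => ?_
  simp_rw [Matrix.updateRow_apply]
  split_ifs
  · exact differentiableOn_const _
  · exact hA a b

/-- A holomorphic family of operators on `ℂⁿ` has a holomorphic determinant and a holomorphic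
adjugate. -/
theorem exists_det_adjugate {n : ℕ} {U : Set ℂ} {B : ℂ → (Fin n → ℂ) →L[ℂ] (Fin n → ℂ)}
    (hB : DifferentiableOn ℂ B U) :
    ∃ (δ : ℂ → ℂ) (A : ℂ → (Fin n → ℂ) →L[ℂ] (Fin n → ℂ)), DifferentiableOn ℂ δ U ∧
      DifferentiableOn ℂ A U ∧ (∀ z v, A z (B z v) = δ z • v) ∧ (∀ z v, B z (A z v) = δ z • v) ∧
      ∀ z, δ z = 0 → ∃ v, v ≠ 0 ∧ B z v = 0 := by
  classical
  set T : ℂ → Matrix (Fin n) (Fin n) ℂ := fun z => LinearMap.toMatrix' (B z : (Fin n → ℂ) →ₗ[ℂ] _)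
    with hT
  have hTd : ∀ j k, DifferentiableOn ℂ (fun z => T z j k) U := by
    intro j k
    have : ∀ z, T z j k = B z (Pi.single k 1) j := by
      intro z
      simp [hT, LinearMap.toMatrix'_apply]
    simp_rw [this]
    exact differentiableOn_pi.1 (hB.clm_apply (differentiableOn_const _)) j
  have hTB : ∀ z v, (T z).mulVec v = B z v := by
    intro z v
    rw [hT, LinearMap.toMatrix'_mulVec]
    rfl
  set A : ℂ → (Fin n → ℂ) →L[ℂ] (Fin n → ℂ) := fun z => ∑ j, ∑ k, (T z).adjugate j k •
    (ContinuousLinearMap.proj k : (Fin n → ℂ) →L[ℂ] ℂ).smulRight (Pi.single j (1 : ℂ)) with hA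
  have hAT : ∀ z v, (T z).adjugate.mulVec v = A z v := by
    intro z v
    ext j
    simp [hA, Matrix.mulVec, dotProduct, Pi.single_apply, Finset.sum_apply]
  refine ⟨fun z => (T z).det, A, DifferentiableOn.matrix_det hTd, ?_, ?_, ?_, ?_⟩
  · refine DifferentiableOn.fun_sum fun j _ => DifferentiableOn.fun_sum fun k _ => ?_
    exact (DifferentiableOn.matrix_adjugate hTd j k).smul_const _
  · intro z v
    rw [← hAT, ← hTB, Matrix.mulVec_mulVec, Matrix.adjugate_mul, Matrix.smul_mulVec,
      Matrix.one_mulVec]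
  · intro z v
    rw [← hAT, ← hTB, Matrix.mulVec_mulVec, Matrix.mul_adjugate, Matrix.smul_mulVec,
      Matrix.one_mulVec]
  · intro z hz
    obtain ⟨v, hv, h⟩ := Matrix.exists_mulVec_eq_zero_iff.2 hz
    exact ⟨v, hv, by rw [← hTB, h]⟩

variable {H : Type*} [NormedAddCommGroup H] [NormedSpace ℂ H]

theorem ringInverse_eq_of_apply {T N : H →L[ℂ] H} (h1 : ∀ x, T (N x) = x) (h2 : ∀ x, N (T x) = x) :
    IsUnit T ∧ Ring.inverse T = N := by
  let u : (H →L[ℂ] H)ˣ := ⟨T, N, ContinuousLinearMap.ext h1, ContinuousLinearMap.ext h2⟩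
  exact ⟨u.isUnit, Ring.inverse_unit u⟩

theorem apply_ringInverse {T : H →L[ℂ] H} (hT : IsUnit T) (x : H) : T (Ring.inverse T x) = x :=
  DFunLike.congr_fun (Ring.mul_inverse_cancel T hT) x

theorem ringInverse_apply {T : H →L[ℂ] H} (hT : IsUnit T) (x : H) : Ring.inverse T (T x) = x :=
  DFunLike.congr_fun (Ring.inverse_mul_cancel T hT) x

/-- Inversion of a finite rank perturbation of an invertible operator. -/
theorem isUnit_finiteRank_perturbation {n : ℕ} {E D : H →L[ℂ] H} (hED : ∀ x, E (D x) = x)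
    (hDE : ∀ x, D (E x) = x) (i : (Fin n → ℂ) →L[ℂ] H) (p : H →L[ℂ] (Fin n → ℂ))
    {A : (Fin n → ℂ) →L[ℂ] (Fin n → ℂ)} {δ : ℂ} (hδ : δ ≠ 0)
    (hA : ∀ v, A (v + p (D (i v))) = δ • v) (hA' : ∀ v, A v + p (D (i (A v))) = δ • v) :
    IsUnit (E + i ∘L p) ∧ Ring.inverse (E + i ∘L p) =
      D - δ⁻¹ • (D ∘L i) ∘L (A ∘L p ∘L D) := by
  -- The Woodbury formula: `δ⁻¹ A` is the inverse of `1 + p D i` on `ℂⁿ`.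
  apply ringInverse_eq_of_apply
  · intro x
    have h := congrArg i (hA' (p (D x)))
    rw [map_add, map_smul] at h
    have h' : i (p (D (i (A (p (D x)))))) = δ • i (p (D x)) - i (A (p (D x))) := by
      rw [← h]; abel
    simp only [add_apply, sub_apply, map_sub, map_smul,
      ContinuousLinearMap.comp_apply, smul_apply, hED]
    rw [h', add_sub_cancel, inv_smul_smul₀ hδ, add_sub_cancel_right]
  · intro x
    have h := hA (p x)
    rw [map_add, ← eq_sub_iff_add_eq'] at h
    simp only [add_apply, sub_apply, map_add,
      ContinuousLinearMap.comp_apply, smul_apply, hDE]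
    rw [h, map_sub, map_sub, map_smul, map_smul, smul_sub, inv_smul_smul₀ hδ]
    abel

variable [CompleteSpace H]

theorem differentiableOn_ringInverse {U : Set ℂ} {T : ℂ → H →L[ℂ] H} (hT : DifferentiableOn ℂ T U)
    (hu : ∀ z ∈ U, IsUnit (T z)) : DifferentiableOn ℂ (fun z => Ring.inverse (T z)) U :=
  fun z hz => (differentiableAt_inverse (𝕜 := ℂ) (hu z hz)).comp_differentiableWithinAt z (hT z hz)

open Filter Topology

/-- The local form of analytic Fredholm theory. -/
theorem exists_local_inverse {M : ℂ → H →L[ℂ] H} (hM : Differentiable ℂ M) {z₀ : ℂ}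
    (hc : IsFiniteRankLimit (M z₀)) :
    ∃ (U : Set ℂ) (n : ℕ) (D : ℂ → H →L[ℂ] H) (P : ℂ → (Fin n → ℂ) →L[ℂ] H)
      (Q : ℂ → H →L[ℂ] (Fin n → ℂ)) (δ : ℂ → ℂ), IsOpen U ∧ z₀ ∈ U ∧ DifferentiableOn ℂ D U ∧
      DifferentiableOn ℂ P U ∧ DifferentiableOn ℂ Q U ∧ DifferentiableOn ℂ δ U ∧
      ∀ z ∈ U, (IsUnit (1 + M z) ↔ δ z ≠ 0) ∧
        (δ z ≠ 0 → Ring.inverse (1 + M z) = D z - (δ z)⁻¹ • P z ∘L Q z) := by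
  -- An error below `1/2` at `z₀` and a variation below `1/2` on `U` keep `E z` within distance less
  -- than `1` of the identity.
  obtain ⟨n, i, p, hip⟩ := hc (1 / 2) (by norm_num)
  set U : Set ℂ := {z | ‖M z - M z₀‖ < 1 / 2} with hU
  have hUo : IsOpen U := isOpen_lt ((hM.continuous.sub continuous_const).norm) continuous_const
  have hz₀ : z₀ ∈ U := by simp [hU]
  set E : ℂ → H →L[ℂ] H := fun z => 1 + M z - i ∘L p with hE
  have hEu : ∀ z ∈ U, IsUnit (E z) := by
    intro z hz
    have h1 : E z = 1 - (i ∘L p - M z) := by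
      simp only [hE]
      abel
    rw [h1]
    apply isUnit_one_sub_of_norm_lt_one
    have h2 : i ∘L p - M z = -(M z₀ - i ∘L p) - (M z - M z₀) := by abel
    have hz' : ‖M z - M z₀‖ < 1 / 2 := hz
    rw [h2]
    calc _ ≤ ‖-(M z₀ - i ∘L p)‖ + ‖M z - M z₀‖ := norm_sub_le _ _
      _ < 1 := by rw [norm_neg]; linarith
  set D : ℂ → H →L[ℂ] H := fun z => Ring.inverse (E z) with hD
  have hEd : Differentiable ℂ E := (hM.const_add 1).sub_const _
  have hDd : DifferentiableOn ℂ D U := differentiableOn_ringInverse hEd.differentiableOn hEu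
  have hPd : DifferentiableOn ℂ (fun z => D z ∘L i) U :=
    hDd.clm_comp (differentiableOn_const _)
  have hpD : DifferentiableOn ℂ (fun z => p ∘L D z) U := (differentiableOn_const _).clm_comp hDd
  -- The problem is reduced to `ℂⁿ`: the determinant of `1 + p D i` decides whether `1 + M z` is
  -- invertible, and its adjugate gives an inverse whose only singular factor is `δ⁻¹`.
  set B : ℂ → (Fin n → ℂ) →L[ℂ] (Fin n → ℂ) := fun z => 1 + p ∘L (D z ∘L i) with hB
  have hBd : DifferentiableOn ℂ B U :=
    ((differentiableOn_const _).clm_comp hPd).const_add _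
  obtain ⟨δ, A, hδd, hAd, hAB, hBA, hker⟩ := exists_det_adjugate hBd
  have hMz : ∀ z, 1 + M z = E z + i ∘L p := fun z => (sub_add_cancel _ _).symm
  have hinv : ∀ z ∈ U, δ z ≠ 0 → IsUnit (1 + M z) ∧ Ring.inverse (1 + M z) =
      D z - (δ z)⁻¹ • (D z ∘L i) ∘L (A z ∘L p ∘L D z) := by
    intro z hz h
    rw [hMz]
    exact isUnit_finiteRank_perturbation (apply_ringInverse (hEu z hz))
      (ringInverse_apply (hEu z hz)) i p h (hAB z) (hBA z)
  refine ⟨U, n, D, fun z => D z ∘L i, fun z => A z ∘L p ∘L D z, δ, hUo, hz₀, hDd, hPd,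
    hAd.clm_comp hpD, hδd, fun z hz => ⟨⟨fun hu h0 => ?_, fun h => (hinv z hz h).1⟩,
      fun h => (hinv z hz h).2⟩⟩
  -- A kernel vector `v` of `B z` yields the kernel element `D i v` of `1 + M z`. If that element is
  -- zero, then `v = -p D i v` is zero as well.
  obtain ⟨v, hv, hBv⟩ := hker z h0
  have hBv' : v + p (D z (i v)) = 0 := hBv
  have h1 : (1 + M z) (D z (i v)) = 0 := by
    rw [hMz]
    have : (E z) (D z (i v)) = i v := apply_ringInverse (hEu z hz) _
    rw [add_apply, this, ContinuousLinearMap.comp_apply, ← map_add, hBv',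
      map_zero]
  have h2 : D z (i v) = 0 := by
    have := ringInverse_apply hu (D z (i v))
    rw [h1, map_zero] at this
    exact this.symm
  rw [h2, map_zero, add_zero] at hBv'
  exact hv hBv'

/-- Analytic Fredholm theory: if `M` is an entire family of norm limits of finite rank operators
and `1 + M z` is invertible for some `z`, then `(1 + M z)⁻¹` is a meromorphic family. -/
theorem exists_meromorphic_inverse {M : ℂ → H →L[ℂ] H} (hM : Differentiable ℂ M)
    (hc : ∀ z, IsFiniteRankLimit (M z)) {z₁ : ℂ} (h₁ : IsUnit (1 + M z₁)) (z₀ : ℂ) :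
    ∃ (U : Set ℂ) (n m : ℕ) (D : ℂ → H →L[ℂ] H) (P : ℂ → (Fin n → ℂ) →L[ℂ] H)
      (Q : ℂ → H →L[ℂ] (Fin n → ℂ)), IsOpen U ∧ z₀ ∈ U ∧ DifferentiableOn ℂ D U ∧
      DifferentiableOn ℂ P U ∧ DifferentiableOn ℂ Q U ∧
      ∀ z ∈ U, z ≠ z₀ → IsUnit (1 + M z) ∧
        Ring.inverse (1 + M z) = D z - ((z - z₀) ^ m)⁻¹ • P z ∘L Q z := by
  -- Near each point the holomorphic determinant either vanishes identically or has no zeros in a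
  -- punctured neighbourhood. The points of the first kind therefore form a clopen set, which misses
  -- `z₁`.
  have hdich : ∀ z, (∀ᶠ w in 𝓝 z, ¬ IsUnit (1 + M w)) ∨ ∀ᶠ w in 𝓝[≠] z, IsUnit (1 + M w) := by
    intro z
    obtain ⟨U, n, D, P, Q, δ, hUo, hz, -, -, -, hδ, h⟩ := exists_local_inverse hM (hc z)
    have hδa : AnalyticAt ℂ δ z := hδ.analyticAt (hUo.mem_nhds hz)
    rcases hδa.eventually_eq_zero_or_eventually_ne_zero with h0 | h0
    · left
      filter_upwards [h0, hUo.mem_nhds hz] with w h1 h2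
      rw [(h w h2).1]
      exact not_not.2 h1
    · right
      filter_upwards [h0, mem_nhdsWithin_of_mem_nhds (hUo.mem_nhds hz)] with w h1 h2
      exact (h w h2).1.2 h1
  have hclopen : IsClopen {z | ∀ᶠ w in 𝓝 z, ¬ IsUnit (1 + M w)} := by
    refine ⟨⟨?_⟩, isOpen_setOfPred_eventually_nhds⟩
    rw [isOpen_iff_mem_nhds]
    intro z hz
    have h := (hdich z).resolve_left hz
    rw [eventually_nhdsWithin_iff] at h
    filter_upwards [h.eventually_nhds] with w hw hw'
    have h2 : ∀ᶠ y in 𝓝[≠] w, False := by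
      by_cases hwz : w = z
      · subst hwz
        rw [eventually_nhdsWithin_iff]
        filter_upwards [h, hw'] with y h3 h4 h5
        exact h4 (h3 h5)
      · rw [eventually_nhdsWithin_iff]
        filter_upwards [hw, hw', isOpen_ne.mem_nhds hwz] with y h3 h4 h5 _
        exact h4 (h3 h5)
    exact h2.exists.elim fun _ h => h
  have hempty : {z | ∀ᶠ w in 𝓝 z, ¬ IsUnit (1 + M w)} = ∅ := by
    rcases isClopen_iff.1 hclopen with h | h
    · exact h
    · exfalso
      have h2 : z₁ ∈ {z | ∀ᶠ w in 𝓝 z, ¬ IsUnit (1 + M w)} := h ▸ mem_univ z₁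
      exact (Eventually.self_of_nhds h2) h₁
  have hne : ∀ᶠ w in 𝓝[≠] z₀, IsUnit (1 + M w) := by
    refine (hdich z₀).resolve_left fun h => ?_
    have h2 : z₀ ∈ {z | ∀ᶠ w in 𝓝 z, ¬ IsUnit (1 + M w)} := h
    rw [hempty] at h2
    exact h2
  obtain ⟨U, n, D, P, Q, δ, hUo, hz, hD, hP, hQ, hδ, h⟩ := exists_local_inverse hM (hc z₀)
  have hδa : AnalyticAt ℂ δ z₀ := hδ.analyticAt (hUo.mem_nhds hz)
  have hnz : ¬ ∀ᶠ z in 𝓝 z₀, δ z = 0 := by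
    intro h0
    have : ∀ᶠ w in 𝓝[≠] z₀, False := by
      filter_upwards [hne, mem_nhdsWithin_of_mem_nhds h0,
        mem_nhdsWithin_of_mem_nhds (hUo.mem_nhds hz)] with w h1 h2 h3
      exact (h w h3).1.1 h1 h2
    exact this.exists.elim fun _ h => h
  -- The zero of the determinant at `z₀` is split off as `(z - z₀)^m`; the nonvanishing factor `g`
  -- is inverted and absorbed into `Q`.
  obtain ⟨m, g, hg, hg0, hδg⟩ := hδa.exists_eventuallyEq_pow_smul_nonzero_iff.2 hnz
  have hgev : ∀ᶠ z in 𝓝 z₀, g z ≠ 0 ∧ DifferentiableAt ℂ g z :=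
    (hg.continuousAt.eventually_ne hg0).and (hg.eventually_analyticAt.mono fun z h =>
      h.differentiableAt)
  rw [eventually_nhdsWithin_iff] at hne
  obtain ⟨W, hW, hWo, hzW⟩ := eventually_nhds_iff.1 ((hgev.and hδg).and hne)
  refine ⟨U ∩ W, n, m, D, P, fun z => (g z)⁻¹ • Q z, hUo.inter hWo, ⟨hz, hzW⟩,
    hD.mono inter_subset_left, hP.mono inter_subset_left, ?_, fun z hzU hzz => ?_⟩
  · have hgi : DifferentiableOn ℂ (fun z => (g z)⁻¹) (U ∩ W) := fun z hz =>
      ((hW z hz.2).1.1.2.inv (hW z hz.2).1.1.1).differentiableWithinAt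
    exact hgi.smul (hQ.mono inter_subset_left)
  · have hu := (hW z hzU.2).2 hzz
    refine ⟨hu, ?_⟩
    have hδz := (h z hzU.1).1.1 hu
    rw [(h z hzU.1).2 hδz, (hW z hzU.2).1.2, smul_eq_mul, mul_inv]
    congr 1
    rw [ContinuousLinearMap.comp_smul, smul_smul]

end Fredholm

/-! ### Holomorphic families of radial functions -/

/-- A family of continuous functions on the line, holomorphic in the parameter uniformly on compact
intervals. -/
def IsHolomorphicRadial (Φ : ℂ → C(ℝ, ℂ)) : Prop :=
  ∀ a b : ℝ, Differentiable ℂ fun z => (Φ z).restrict (Icc a b)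

/-- Difference quotients of holomorphic families of radial functions are holomorphic. -/
theorem IsHolomorphicRadial.exists_slope {Φ : ℂ → C(ℝ, ℂ)} (hΦ : IsHolomorphicRadial Φ) (z₀ : ℂ) :
    ∃ Φ' : ℂ → C(ℝ, ℂ), IsHolomorphicRadial Φ' ∧ ∀ z, Φ z = Φ z₀ + (z - z₀) • Φ' z := by
  have hd : ∀ a b : ℝ, Differentiable ℂ (dslope (fun z => (Φ z).restrict (Icc a b)) z₀) := by
    intro a b
    rw [← differentiableOn_univ, Complex.differentiableOn_dslope Filter.univ_mem,
      differentiableOn_univ]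
    exact hΦ a b
  have heval : ∀ (a b : ℝ) (z : ℂ) (r : Icc a b),
      dslope (fun w => Φ w r) z₀ z = dslope (fun w => (Φ w).restrict (Icc a b)) z₀ z r := by
    intro a b z r
    exact (ContinuousMap.evalCLM ℂ r).dslope_comp (fun w => (Φ w).restrict (Icc a b)) z₀ z
      (fun _ => (hΦ a b) z₀)
  have hc : ∀ z, Continuous fun r : ℝ => dslope (fun w => Φ w r) z₀ z := by
    intro z
    rw [continuous_iff_continuousAt]
    intro r
    -- Near `r` the pointwise slope is the evaluation of the slope taken in the Banach space of
    -- continuous functions on `[r-1, r+1]`, hence continuous.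
    have h1 : ContinuousOn (fun r : ℝ => dslope (fun w => Φ w r) z₀ z) (Icc (r - 1) (r + 1)) := by
      rw [continuousOn_iff_continuous_domRestrict]
      have : (Icc (r - 1) (r + 1)).domRestrict (fun r : ℝ => dslope (fun w => Φ w r) z₀ z) =
          dslope (fun w => (Φ w).restrict (Icc (r - 1) (r + 1))) z₀ z :=
        funext fun s => heval _ _ z s
      rw [this]
      exact ContinuousMap.continuous _
    exact h1.continuousAt (Icc_mem_nhds (by linarith) (by linarith))
  refine ⟨fun z => ⟨_, hc z⟩, fun a b => ?_, fun z => ?_⟩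
  · have : (fun z => (⟨_, hc z⟩ : C(ℝ, ℂ)).restrict (Icc a b)) =
        dslope (fun z => (Φ z).restrict (Icc a b)) z₀ := by
      funext z
      ext r
      exact heval a b z r
    rw [this]
    exact hd a b
  · ext r
    have := sub_smul_dslope (fun w => Φ w r) z₀ z
    change Φ z r = Φ z₀ r + (z - z₀) • dslope (fun w => Φ w r) z₀ z
    rw [this]
    ring

/-- The radial functions `exp(i z r) / 4π` of the free outgoing resolvent. -/
def expRadial (z : ℂ) : C(ℝ, ℂ) :=
  ⟨fun r => (4 * Real.pi : ℂ)⁻¹ * Complex.exp (z * (Complex.I * r)), by fun_prop⟩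

/-- On a compact interval the family is, up to a constant, the exponential of `z • g` in the Banach
algebra of continuous functions, with `g(r) = ir`. -/
theorem isHolomorphicRadial_expRadial : IsHolomorphicRadial expRadial := by
  intro a b
  set g : C(Icc a b, ℂ) := ⟨fun r => Complex.I * (r : ℝ), by fun_prop⟩ with hg
  have : (fun z => (expRadial z).restrict (Icc a b)) =
      fun z => (4 * Real.pi : ℂ)⁻¹ • NormedSpace.exp (z • g) := by
    funext z
    ext r
    have h := NormedSpace.map_exp (ContinuousMap.evalAlgHom ℂ ℂ r)
      (ContinuousMap.evalCLM ℂ r).continuous (z • g)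
    have h' : (NormedSpace.exp (z • g)) r = NormedSpace.exp ((z • g) r) := h
    rw [ContinuousMap.smul_apply, h', ← Complex.exp_eq_exp_ℂ]
    simp [expRadial, hg]
  rw [this]
  exact fun z => ((hasDerivAt_exp_smul_const g z).differentiableAt).fun_const_smul _

/-- Each truncation is a fixed bounded linear map applied to the restriction of the radial function
to one compact interval, so holomorphy is inherited. -/
theorem isHolomorphicFamilyOn_radialOp {Φ : ℂ → C(ℝ, ℂ)} (hΦ : IsHolomorphicRadial Φ) (U : Set ℂ) :
    IsHolomorphicFamilyOn (fun z => radialOp (Φ z)) U := by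
  intro K L
  obtain ⟨d, τ, hτ⟩ := exists_truncation_radialOp K L
  exact ⟨fun z => τ ((Φ z).restrict (Icc 0 d)), (τ.differentiable.comp (hΦ 0 d)).differentiableOn,
    fun z _ f => hτ (Φ z) f⟩

/-! ### The free outgoing resolvent and its agreement with the Fourier multiplier -/

/-- The inclusion `L² → L²_loc`. -/
def toLoc : L2 →ₗ[ℂ] L2Loc where
  toFun f := ⟨f.1, fun _ _ => (Lp.memLp f).restrict _⟩
  map_add' _ _ := rfl
  map_smul' _ _ := rfl

theorem toAEEqFun_toLoc (f : L2) : (toLoc f).toAEEqFun = f := rfl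

/-- Multiplication by the characteristic function of a compact set on `L²`. -/
def cutL2 (K : TopologicalSpace.Compacts E3) : L2 →L[ℂ] L2 :=
  LinearMap.mkContinuous (cutLoc K ∘ₗ toLoc) 1 (by
    intro f
    rw [one_mul]
    apply Lp.norm_le_norm_of_ae_le
    filter_upwards [coeFn_cutLoc K (toLoc f)] with x hx
    rw [LinearMap.comp_apply, hx]
    exact norm_indicator_le_norm_self _ _)

theorem cutL2_apply (K : TopologicalSpace.Compacts E3) (f : L2) : cutL2 K f = cutLoc K (toLoc f) :=
  rfl

theorem coe_cutComp (K : TopologicalSpace.Compacts E3) (f : L2) :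
    (cutComp K f : L2) = cutL2 K f := rfl

theorem cutL2_eq_self {K : TopologicalSpace.Compacts E3} {f : L2} (hf : ∀ᵐ x, x ∉ K → f x = 0) :
    cutL2 K f = f := by
  apply Lp.ext
  filter_upwards [coeFn_cutLoc K (toLoc f), hf] with x h1 h2
  rw [cutL2_apply, h1]
  by_cases h : x ∈ (K : Set E3)
  · rw [indicator_of_mem h, toAEEqFun_toLoc]
  · rw [indicator_of_notMem h, h2 h]

theorem exists_cutComp_eq (f : L2Comp) : ∃ L : TopologicalSpace.Compacts E3, cutComp L f = f := by
  obtain ⟨L, hL, hf⟩ := f.2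
  exact ⟨⟨L, hL⟩, Subtype.ext (cutL2_eq_self (K := ⟨L, hL⟩) hf)⟩

theorem L2Loc.ext_cutLoc {f g : L2Loc} (h : ∀ K, cutLoc K f = cutLoc K g) : f = g := by
  apply L2Loc.ext
  have hK : ∀ n : ℕ, ∀ᵐ x : E3, x ∈ Metric.closedBall (0 : E3) n →
      f.toAEEqFun x = g.toAEEqFun x := by
    intro n
    let K : TopologicalSpace.Compacts E3 := ⟨Metric.closedBall 0 n, isCompact_closedBall _ _⟩
    filter_upwards [coeFn_cutLoc K f, coeFn_cutLoc K g] with x h1 h2 hx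
    rw [h K, h2, indicator_of_mem (show x ∈ (K : Set E3) from hx),
      indicator_of_mem (show x ∈ (K : Set E3) from hx)] at h1
    exact h1.symm
  filter_upwards [ae_all_iff.2 hK] with x hx
  obtain ⟨n, hn⟩ := exists_nat_ge ‖x‖
  exact hx n (by simpa using hn)

/-- Operators `L²_comp → L²_loc` are determined by their truncations. -/
theorem eq_of_truncation_eq {A B : L2Comp →ₗ[ℂ] L2Loc}
    (h : ∀ K L f, truncation K L A f = truncation K L B f) : A = B := by
  ext1 f
  obtain ⟨L, hL⟩ := exists_cutComp_eq f
  apply L2Loc.ext_cutLoc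
  intro K
  have := h K L f
  simp only [truncation, LinearMap.comp_apply, hL] at this
  exact this

theorem freeResolvent_eq_iff {z : ℂ} (hz : 0 < z.im) (u f : L2) :
    SchrodingerGraph 0 u (f + z ^ 2 • u) ↔ u = freeResolvent z f := by
  rw [schrodingerGraph_iff_eq_freeResolvent 0 hz, mulOp_apply, Lp.zero_smul, sub_zero]

/-- The resolvent identity. -/
theorem freeResolvent_eq_comp {z w : ℂ} (hz : 0 < z.im) (hw : 0 < w.im) (f : L2) :
    freeResolvent z f = freeResolvent w (f + (z ^ 2 - w ^ 2) • freeResolvent z f) := by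
  rw [← freeResolvent_eq_iff hw]
  have h := (freeResolvent_eq_iff hz (freeResolvent z f) f).2 rfl
  convert h using 1
  rw [sub_smul]
  abel

/-- With `J` the resolvent at `i`, the resolvent identity says that `1 - (z² - i²)J` has the inverse
`1 + (z² - i²)R₀(z)`. So `R₀(z)` is `J` composed with the inverse of a polynomial family. -/
theorem differentiableOn_freeResolvent :
    DifferentiableOn ℂ freeResolvent {z | 0 < z.im} := by
  set J := freeResolvent Complex.I with hJ
  have hI : 0 < Complex.I.im := by simp
  have key : ∀ z : ℂ, 0 < z.im → IsUnit (1 - (z ^ 2 - Complex.I ^ 2) • J) ∧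
      Ring.inverse (1 - (z ^ 2 - Complex.I ^ 2) • J) =
        1 + (z ^ 2 - Complex.I ^ 2) • freeResolvent z := by
    intro z hz
    set c := z ^ 2 - Complex.I ^ 2 with hc
    apply ringInverse_eq_of_apply
    · intro f
      have h := freeResolvent_eq_comp hz hI f
      rw [← hc, ← hJ] at h
      change (f + c • freeResolvent z f) - c • J (f + c • freeResolvent z f) = f
      rw [← h, add_sub_cancel_right]
    · intro f
      have h := freeResolvent_eq_comp hI hz f
      have e : Complex.I ^ 2 - z ^ 2 = -c := by rw [hc]; ring
      rw [e, ← hJ, neg_smul, ← sub_eq_add_neg] at h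
      change (f - c • J f) + c • freeResolvent z (f - c • J f) = f
      rw [← h, sub_add_cancel]
  have heq : ∀ z ∈ {z : ℂ | 0 < z.im}, freeResolvent z =
      J ∘L Ring.inverse (1 - (z ^ 2 - Complex.I ^ 2) • J) := by
    intro z hz
    rw [(key z hz).2]
    ext1 f
    exact freeResolvent_eq_comp hz hI f
  refine DifferentiableOn.congr ?_ heq
  refine (differentiableOn_const _).clm_comp (differentiableOn_ringInverse ?_ fun z hz =>
    (key z hz).1)
  fun_prop

theorem integrable_of_mem_L2Comp (f : L2Comp) : Integrable (f : L2) := by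
  obtain ⟨L, hL, hf⟩ := f.2
  have : IsFiniteMeasure (volume.restrict L) := ⟨by simpa using hL.measure_lt_top⟩
  have h1 : IntegrableOn (f : L2) L :=
    ((Lp.memLp (f : L2)).restrict L).integrable (by norm_num)
  exact h1.integrable_of_ae_notMem_eq_zero hf

/-- The free outgoing resolvent, with kernel `exp(i z |x - y|) / (4π |x - y|)`. -/
def outgoing (z : ℂ) : L2Comp →ₗ[ℂ] L2Loc := radialOp (expRadial z)

theorem outgoing_eq_freeResolvent_of_pos {κ : ℝ} (hκ : 0 < κ) (f : L2Comp) :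
    outgoing (κ * Complex.I) f = toLoc (freeResolvent (κ * Complex.I) f) := by
  apply L2Loc.ext
  filter_upwards [coeFn_radialOp (expRadial (κ * Complex.I)) f,
    freeResolvent_ae_eq_integral hκ (integrable_of_mem_L2Comp f)] with x h1 h2
  rw [outgoing, h1, toAEEqFun_toLoc, h2, radialConv]
  congr 1
  ext y
  congr 1
  rw [radialKernel, expRadial, greenFunction]
  simp only [ContinuousMap.coe_mk]
  have e : (κ : ℂ) * Complex.I * (Complex.I * (‖x - y‖ : ℝ)) = ((-(κ * ‖x - y‖) : ℝ) : ℂ) := by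
    push_cast
    linear_combination (κ * ‖x - y‖ : ℂ) * Complex.I_mul_I
  rw [e, ← Complex.ofReal_exp]
  push_cast
  rw [mul_comm, ← div_eq_mul_inv, div_div]

open Filter Topology in
/-- In the upper half plane, the free outgoing resolvent is the inverse of `-Δ - z²` on `L²`. -/
theorem outgoing_eq_freeResolvent {z : ℂ} (hz : 0 < z.im) (f : L2Comp) :
    outgoing z f = toLoc (freeResolvent z f) := by
  obtain ⟨L, hL⟩ := exists_cutComp_eq f
  apply L2Loc.ext_cutLoc
  intro K
  obtain ⟨B, hB, hBf⟩ := isHolomorphicFamilyOn_radialOp isHolomorphicRadial_expRadial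
    {z | 0 < z.im} K L
  have hopen : IsOpen {z : ℂ | 0 < z.im} := isOpen_lt continuous_const Complex.continuous_im
  have hG : DifferentiableOn ℂ (fun z => cutL2 K ∘L freeResolvent z ∘L cutL2 L) {z | 0 < z.im} :=
    (differentiableOn_const _).clm_comp (differentiableOn_freeResolvent.clm_comp
      (differentiableOn_const _))
  have hline : ∀ κ : ℝ, 0 < κ →
      B (κ * Complex.I) = cutL2 K ∘L freeResolvent (κ * Complex.I) ∘L cutL2 L := by
    intro κ hκ
    ext1 g
    rw [hBf _ (by simpa using hκ)]
    change cutLoc K (outgoing (κ * Complex.I) (cutComp L g)) = _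
    rw [outgoing_eq_freeResolvent_of_pos hκ]
    rfl
  -- The Green function covers only the positive imaginary axis. This set accumulates at `i`, which
  -- is enough for the identity theorem on the half plane.
  have hfreq : ∃ᶠ w in 𝓝[≠] Complex.I, B w = cutL2 K ∘L freeResolvent w ∘L cutL2 L := by
    have ht : Tendsto (fun κ : ℝ => (κ : ℂ) * Complex.I) (𝓝[≠] 1) (𝓝[≠] Complex.I) := by
      refine tendsto_nhdsWithin_iff.2 ⟨?_, ?_⟩
      · have hc : Continuous fun κ : ℝ => (κ : ℂ) * Complex.I := by fun_prop
        have := hc.tendsto 1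
        simp only [Complex.ofReal_one, one_mul] at this
        exact this.mono_left nhdsWithin_le_nhds
      · filter_upwards [self_mem_nhdsWithin] with κ hκ h
        apply hκ
        have h' := congrArg Complex.im h
        simpa using h'
    refine ht.frequently (Eventually.frequently ?_)
    filter_upwards [mem_nhdsWithin_of_mem_nhds (Ioi_mem_nhds one_pos)] with κ hκ
    exact hline κ hκ
  have hEq := (hB.analyticOnNhd hopen).eqOn_of_preconnected_of_frequently_eq
    (hG.analyticOnNhd hopen) (convex_halfSpace_im_gt 0).isPreconnected
    (show Complex.I ∈ {z : ℂ | 0 < z.im} by simp) hfreq hz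
  have h1 := hBf z hz (f : L2)
  rw [hEq] at h1
  have h2 : cutL2 L (f : L2) = f := congrArg Subtype.val hL
  simp only [truncation, LinearMap.comp_apply, hL, ContinuousLinearMap.comp_apply, h2] at h1
  exact h1.symm

/-! ### Calculus of holomorphic families and finite rank principal parts -/

theorem IsHolomorphicFamilyOn.isContinuousOperator {A : ℂ → L2Comp →ₗ[ℂ] L2Loc} {U : Set ℂ}
    (hA : IsHolomorphicFamilyOn A U) {z : ℂ} (hz : z ∈ U) : IsContinuousOperator (A z) := by
  intro K L
  obtain ⟨B, -, hB⟩ := hA K L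
  exact ⟨B z, hB z hz⟩

theorem IsHolomorphicFamilyOn.mono {A : ℂ → L2Comp →ₗ[ℂ] L2Loc} {U U' : Set ℂ}
    (hA : IsHolomorphicFamilyOn A U) (h : U' ⊆ U) : IsHolomorphicFamilyOn A U' := by
  intro K L
  obtain ⟨B, hBd, hB⟩ := hA K L
  exact ⟨B, hBd.mono h, fun z hz => hB z (h hz)⟩

theorem IsHolomorphicFamilyOn.congr {A A' : ℂ → L2Comp →ₗ[ℂ] L2Loc} {U : Set ℂ}
    (hA : IsHolomorphicFamilyOn A U) (h : ∀ z ∈ U, A' z = A z) : IsHolomorphicFamilyOn A' U := by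
  intro K L
  obtain ⟨B, hBd, hB⟩ := hA K L
  exact ⟨B, hBd, fun z hz => by rw [h z hz]; exact hB z hz⟩

theorem IsHolomorphicFamilyOn.add {A A' : ℂ → L2Comp →ₗ[ℂ] L2Loc} {U : Set ℂ}
    (hA : IsHolomorphicFamilyOn A U) (hA' : IsHolomorphicFamilyOn A' U) :
    IsHolomorphicFamilyOn (fun z => A z + A' z) U := by
  intro K L
  obtain ⟨B, hBd, hB⟩ := hA K L
  obtain ⟨B', hBd', hB'⟩ := hA' K L
  refine ⟨fun z => B z + B' z, hBd.add hBd', fun z hz f => ?_⟩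
  rw [truncation_add, LinearMap.add_apply, add_apply, hB z hz, hB' z hz]

theorem IsHolomorphicFamilyOn.const_smul {A : ℂ → L2Comp →ₗ[ℂ] L2Loc} {U : Set ℂ}
    (hA : IsHolomorphicFamilyOn A U) (c : ℂ) :
    IsHolomorphicFamilyOn (fun z => c • A z) U := by
  intro K L
  obtain ⟨B, hBd, hB⟩ := hA K L
  refine ⟨fun z => c • B z, hBd.const_smul c, fun z hz f => ?_⟩
  rw [truncation_smul, LinearMap.smul_apply, smul_apply, hB z hz]

theorem isHolomorphicFamilyOn_zero (U : Set ℂ) :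
    IsHolomorphicFamilyOn (fun _ => 0) U := fun K L =>
  ⟨fun _ => 0, differentiableOn_const _, fun z _ f => by simp [truncation]⟩

/-- Holomorphy of a family of operators is a local property. -/
theorem isHolomorphicFamilyOn_of_locally {A : ℂ → L2Comp →ₗ[ℂ] L2Loc} {U : Set ℂ}
    (h : ∀ z ∈ U, ∃ W, IsOpen W ∧ z ∈ W ∧ IsHolomorphicFamilyOn A W) :
    IsHolomorphicFamilyOn A U := by
  classical
  intro K L
  have hex : ∀ z ∈ U, ∃ B : L2 →L[ℂ] L2, ∀ f, B f = truncation K L (A z) f := by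
    intro z hz
    obtain ⟨W, -, hzW, hW⟩ := h z hz
    exact hW.isContinuousOperator hzW K L
  -- At each parameter the bounded operator is determined by the truncation, so any choice agrees
  -- with the local holomorphic families.
  choose! B hB using hex
  refine ⟨B, fun z hz => ?_, hB⟩
  obtain ⟨W, hWo, hzW, hW⟩ := h z hz
  obtain ⟨B', hBd', hB'⟩ := hW K L
  have hd : DifferentiableAt ℂ B' z := hBd'.differentiableAt (hWo.mem_nhds hzW)
  refine hd.differentiableWithinAt.congr_of_eventuallyEq ?_ ?_
  · filter_upwards [self_mem_nhdsWithin, mem_nhdsWithin_of_mem_nhds (hWo.mem_nhds hzW)]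
      with w hw hwW
    ext1 f
    rw [hB w hw, hB' w hwW]
  · ext1 f
    rw [hB z hz, hB' z hzW]

theorem IsContinuousOperator.add {A B : L2Comp →ₗ[ℂ] L2Loc} (hA : IsContinuousOperator A)
    (hB : IsContinuousOperator B) : IsContinuousOperator (A + B) := by
  intro K L
  obtain ⟨T, hT⟩ := hA K L
  obtain ⟨T', hT'⟩ := hB K L
  refine ⟨T + T', fun f => ?_⟩
  rw [truncation_add, LinearMap.add_apply, add_apply, hT, hT']

theorem isContinuousOperator_zero : IsContinuousOperator 0 := fun K L =>
  ⟨0, fun f => by simp [truncation]⟩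

/-- Near `z₀` and away from `z₀`, the family `A` is the sum of a finite principal part, with
continuous coefficients of finite rank, and a holomorphic family. -/
def HasFiniteRankPrincipalPartAt (A : ℂ → L2Comp →ₗ[ℂ] L2Loc) (z₀ : ℂ) : Prop :=
  ∃ (J : ℕ) (a : ℕ → L2Comp →ₗ[ℂ] L2Loc) (A₀ : ℂ → L2Comp →ₗ[ℂ] L2Loc) (U : Set ℂ),
    (∀ j, IsContinuousOperator (a j) ∧ FiniteDimensional ℂ (LinearMap.range (a j))) ∧
    (∀ j, J < j → a j = 0) ∧ IsOpen U ∧ z₀ ∈ U ∧ IsHolomorphicFamilyOn A₀ U ∧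
    ∀ z ∈ U, z ≠ z₀ → A z = ∑ j ∈ Finset.Icc 1 J, ((z - z₀) ^ j)⁻¹ • a j + A₀ z

theorem sum_Icc_eq_of_le {J J' : ℕ} (h : J ≤ J') {a : ℕ → L2Comp →ₗ[ℂ] L2Loc}
    (ha : ∀ j, J < j → a j = 0) (c : ℕ → ℂ) :
    ∑ j ∈ Finset.Icc 1 J, c j • a j = ∑ j ∈ Finset.Icc 1 J', c j • a j := by
  refine Finset.sum_subset (Finset.Icc_subset_Icc_right h) fun j hj hj' => ?_
  rw [ha j, smul_zero]
  by_contra hlt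
  exact hj' (Finset.mem_Icc.2 ⟨(Finset.mem_Icc.1 hj).1, not_lt.1 hlt⟩)

/-- Principal parts, unlike poles, are closed under sums, since leading coefficients are allowed to
cancel. -/
theorem HasFiniteRankPrincipalPartAt.add {A B : ℂ → L2Comp →ₗ[ℂ] L2Loc} {z₀ : ℂ}
    (hA : HasFiniteRankPrincipalPartAt A z₀) (hB : HasFiniteRankPrincipalPartAt B z₀) :
    HasFiniteRankPrincipalPartAt (fun z => A z + B z) z₀ := by
  obtain ⟨J, a, A₀, U, ha, haJ, hU, hzU, hA₀, h⟩ := hA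
  obtain ⟨J', b, B₀, U', hb, hbJ, hU', hzU', hB₀, h'⟩ := hB
  refine ⟨max J J', fun j => a j + b j, fun z => A₀ z + B₀ z, U ∩ U', fun j => ⟨(ha j).1.add (hb j).1,
    ?_⟩, fun j hj => ?_, hU.inter hU', ⟨hzU, hzU'⟩, (hA₀.mono inter_subset_left).add
    (hB₀.mono inter_subset_right), fun z hz hzz => ?_⟩
  · have := (ha j).2
    have := (hb j).2
    exact Submodule.finiteDimensional_of_le (LinearMap.range_add_le _ _)
  · dsimp only
    rw [haJ j ((le_max_left _ _).trans_lt hj), hbJ j ((le_max_right _ _).trans_lt hj), add_zero]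
  · simp_rw [smul_add]
    rw [h z hz.1 hzz, h' z hz.2 hzz, Finset.sum_add_distrib,
      sum_Icc_eq_of_le (le_max_left J J') haJ, sum_Icc_eq_of_le (le_max_right J J') hbJ]
    abel

theorem HasFiniteRankPrincipalPartAt.congr {A B : ℂ → L2Comp →ₗ[ℂ] L2Loc} {z₀ : ℂ} {W : Set ℂ}
    (hA : HasFiniteRankPrincipalPartAt A z₀) (hW : IsOpen W) (hz : z₀ ∈ W)
    (h : ∀ z ∈ W, z ≠ z₀ → B z = A z) : HasFiniteRankPrincipalPartAt B z₀ := by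
  obtain ⟨J, a, A₀, U, ha, haJ, hU, hzU, hA₀, hAz⟩ := hA
  refine ⟨J, a, A₀, U ∩ W, ha, haJ, hU.inter hW, ⟨hzU, hz⟩, hA₀.mono inter_subset_left,
    fun z hz hzz => ?_⟩
  rw [h z hz.2 hzz, hAz z hz.1 hzz]

theorem IsHolomorphicFamilyOn.hasFiniteRankPrincipalPartAt {A : ℂ → L2Comp →ₗ[ℂ] L2Loc}
    {U : Set ℂ} (hA : IsHolomorphicFamilyOn A U) (hU : IsOpen U) {z₀ : ℂ} (hz : z₀ ∈ U) :
    HasFiniteRankPrincipalPartAt A z₀ := by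
  refine ⟨0, fun _ => 0, A, U, fun j => ⟨isContinuousOperator_zero, ?_⟩, fun _ _ => rfl, hU, hz, hA,
    fun z _ _ => by simp⟩
  rw [LinearMap.range_zero]
  infer_instance

theorem hasFiniteRankPrincipalPartAt_inv_pow_smul {a : L2Comp →ₗ[ℂ] L2Loc}
    (ha : IsContinuousOperator a) (hfin : FiniteDimensional ℂ (LinearMap.range a)) (m : ℕ) (z₀ : ℂ) :
    HasFiniteRankPrincipalPartAt (fun z => ((z - z₀) ^ (m + 1))⁻¹ • a) z₀ := by
  classical
  have hprop : ∀ b : L2Comp →ₗ[ℂ] L2Loc, b = a ∨ b = 0 →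
      IsContinuousOperator b ∧ FiniteDimensional ℂ (LinearMap.range b) := by
    rintro b (rfl | rfl)
    · exact ⟨ha, hfin⟩
    · refine ⟨isContinuousOperator_zero, ?_⟩
      rw [LinearMap.range_zero]
      infer_instance
  refine ⟨m + 1, fun j => if j = m + 1 then a else 0, fun _ => 0, univ, fun j => hprop _ ?_,
    fun j hj => ?_, isOpen_univ, mem_univ _, isHolomorphicFamilyOn_zero _, fun z _ _ => ?_⟩
  · by_cases hj : j = m + 1
    · exact Or.inl (if_pos hj)
    · exact Or.inr (if_neg hj)
  · exact if_neg (by omega)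
  · simp

/-- The operator `R_φ 1_K D 1_K R_ψ`, with convolution operators `R_φ` and `R_ψ`. -/
def sandwich (K : TopologicalSpace.Compacts E3) (φ : C(ℝ, ℂ)) (D : L2 →L[ℂ] L2) (ψ : C(ℝ, ℂ)) :
    L2Comp →ₗ[ℂ] L2Loc :=
  radialOp φ ∘ₗ cutComp K ∘ₗ (D : L2 →ₗ[ℂ] L2) ∘ₗ cutLoc K ∘ₗ radialOp ψ

theorem sandwich_apply (K : TopologicalSpace.Compacts E3) (φ : C(ℝ, ℂ)) (D : L2 →L[ℂ] L2)
    (ψ : C(ℝ, ℂ)) (f : L2Comp) :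
    sandwich K φ D ψ f = radialOp φ (cutComp K (D (cutLoc K (radialOp ψ f)))) := rfl

theorem sandwich_add_smul_left (K : TopologicalSpace.Compacts E3) (φ φ' : C(ℝ, ℂ)) (c : ℂ)
    (D : L2 →L[ℂ] L2) (ψ : C(ℝ, ℂ)) :
    sandwich K (φ + c • φ') D ψ = sandwich K φ D ψ + c • sandwich K φ' D ψ := by
  ext1 f
  rw [LinearMap.add_apply, LinearMap.smul_apply]
  simp only [sandwich_apply, map_add, map_smul, LinearMap.add_apply, LinearMap.smul_apply]

theorem sandwich_add_smul_middle (K : TopologicalSpace.Compacts E3) (φ : C(ℝ, ℂ)) (c : ℂ)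
    (D D' : L2 →L[ℂ] L2) (ψ : C(ℝ, ℂ)) :
    sandwich K φ (D + c • D') ψ = sandwich K φ D ψ + c • sandwich K φ D' ψ := by
  ext1 f
  rw [LinearMap.add_apply, LinearMap.smul_apply]
  simp only [sandwich_apply, map_add, map_smul, add_apply, smul_apply]

theorem sandwich_add_smul_right (K : TopologicalSpace.Compacts E3) (φ : C(ℝ, ℂ)) (c : ℂ)
    (D : L2 →L[ℂ] L2) (ψ ψ' : C(ℝ, ℂ)) :
    sandwich K φ D (ψ + c • ψ') = sandwich K φ D ψ + c • sandwich K φ D ψ' := by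
  ext1 f
  rw [LinearMap.add_apply, LinearMap.smul_apply]
  simp only [sandwich_apply, map_add, map_smul, LinearMap.add_apply, LinearMap.smul_apply]

theorem isHolomorphicFamilyOn_sandwich (K : TopologicalSpace.Compacts E3) {Φ Ψ : ℂ → C(ℝ, ℂ)}
    (hΦ : IsHolomorphicRadial Φ) (hΨ : IsHolomorphicRadial Ψ) {D : ℂ → L2 →L[ℂ] L2} {U : Set ℂ}
    (hD : DifferentiableOn ℂ D U) : IsHolomorphicFamilyOn (fun z => sandwich K (Φ z) (D z) (Ψ z)) U := by
  intro K' L'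
  obtain ⟨B, hB, hBf⟩ := isHolomorphicFamilyOn_radialOp hΦ U K' K
  obtain ⟨B', hB', hBf'⟩ := isHolomorphicFamilyOn_radialOp hΨ U K L'
  refine ⟨fun z => B z ∘L D z ∘L B' z, hB.clm_comp (hD.clm_comp hB'), fun z hz f => ?_⟩
  rw [ContinuousLinearMap.comp_apply, ContinuousLinearMap.comp_apply, hBf z hz, hBf' z hz]
  rfl

theorem isHolomorphicRadial_const (φ : C(ℝ, ℂ)) : IsHolomorphicRadial fun _ => φ :=
  fun _ _ => differentiable_const _

theorem isContinuousOperator_sandwich (K : TopologicalSpace.Compacts E3) (φ : C(ℝ, ℂ))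
    (D : L2 →L[ℂ] L2) (ψ : C(ℝ, ℂ)) : IsContinuousOperator (sandwich K φ D ψ) :=
  (isHolomorphicFamilyOn_sandwich K (isHolomorphicRadial_const φ) (isHolomorphicRadial_const ψ)
    (differentiableOn_const D)).isContinuousOperator (mem_univ (0 : ℂ))

theorem finiteDimensional_range_sandwich (K : TopologicalSpace.Compacts E3) (φ ψ : C(ℝ, ℂ)) {n : ℕ}
    (P : (Fin n → ℂ) →L[ℂ] L2) (Q : L2 →L[ℂ] (Fin n → ℂ)) :
    FiniteDimensional ℂ (LinearMap.range (sandwich K φ (P ∘L Q) ψ)) := by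
  have h : sandwich K φ (P ∘L Q) ψ = (radialOp φ ∘ₗ cutComp K ∘ₗ (P : (Fin n → ℂ) →ₗ[ℂ] L2)) ∘ₗ
    ((Q : L2 →ₗ[ℂ] (Fin n → ℂ)) ∘ₗ cutLoc K ∘ₗ radialOp ψ) := rfl
  rw [h]
  exact Submodule.finiteDimensional_of_le (LinearMap.range_comp_le_range _ _)

theorem DifferentiableOn.exists_slope {E : Type*} [NormedAddCommGroup E] [NormedSpace ℂ E]
    [CompleteSpace E] {U : Set ℂ} (hU : IsOpen U) {z₀ : ℂ} (hz : z₀ ∈ U) {P : ℂ → E}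
    (hP : DifferentiableOn ℂ P U) :
    ∃ P' : ℂ → E, DifferentiableOn ℂ P' U ∧ ∀ z, P z = P z₀ + (z - z₀) • P' z :=
  ⟨dslope P z₀, (Complex.differentiableOn_dslope (hU.mem_nhds hz)).2 hP, fun z => by
    rw [sub_smul_dslope, add_sub_cancel]⟩

/-- Dividing a holomorphic family that factors through `ℂⁿ` by a power of `z - z₀` leads to a
principal part of finite rank. -/
theorem hasFiniteRankPrincipalPartAt_sandwich (K : TopologicalSpace.Compacts E3) {n : ℕ} {U : Set ℂ}
    (hU : IsOpen U) {z₀ : ℂ} (hz : z₀ ∈ U) (m : ℕ) :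
    ∀ {Φ Ψ : ℂ → C(ℝ, ℂ)} {P : ℂ → (Fin n → ℂ) →L[ℂ] L2} {Q : ℂ → L2 →L[ℂ] (Fin n → ℂ)},
      IsHolomorphicRadial Φ → IsHolomorphicRadial Ψ → DifferentiableOn ℂ P U →
      DifferentiableOn ℂ Q U → HasFiniteRankPrincipalPartAt
        (fun z => ((z - z₀) ^ m)⁻¹ • sandwich K (Φ z) (P z ∘L Q z) (Ψ z)) z₀ := by
  induction m with
  | zero =>
    intro Φ Ψ P Q hΦ hΨ hP hQ
    simp only [pow_zero, inv_one, one_smul]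
    exact (isHolomorphicFamilyOn_sandwich K hΦ hΨ (hP.clm_comp hQ)).hasFiniteRankPrincipalPartAt hU hz
  | succ m ih =>
    intro Φ Ψ P Q hΦ hΨ hP hQ
    -- Each of the four factors is its value at `z₀` plus `z - z₀` times a holomorphic slope.
    -- Freezing `Ψ`, `Q`, `P`, `Φ` in turn, every slope term gains a factor `z - z₀` and falls under
    -- the induction hypothesis. The completely frozen term is a coefficient of finite rank.
    obtain ⟨Φ', hΦ', eΦ⟩ := hΦ.exists_slope z₀
    obtain ⟨Ψ', hΨ', eΨ⟩ := hΨ.exists_slope z₀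
    obtain ⟨P', hP', eP⟩ := hP.exists_slope hU hz
    obtain ⟨Q', hQ', eQ⟩ := hQ.exists_slope hU hz
    have h0 := hasFiniteRankPrincipalPartAt_inv_pow_smul
      (isContinuousOperator_sandwich K (Φ z₀) (P z₀ ∘L Q z₀) (Ψ z₀))
      (finiteDimensional_range_sandwich K (Φ z₀) (Ψ z₀) (P z₀) (Q z₀)) m z₀
    have hP₀ : DifferentiableOn ℂ (fun _ : ℂ => P z₀) U := differentiableOn_const _
    have hQ₀ : DifferentiableOn ℂ (fun _ : ℂ => Q z₀) U := differentiableOn_const _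
    have h1 := ih hΦ' (isHolomorphicRadial_const (Ψ z₀)) hP₀ hQ₀
    have h2 := ih hΦ (isHolomorphicRadial_const (Ψ z₀)) hP' hQ₀
    have h3 := ih hΦ (isHolomorphicRadial_const (Ψ z₀)) hP hQ'
    have h4 := ih hΦ hΨ' hP hQ
    refine ((((h0.add h1).add h2).add h3).add h4).congr isOpen_univ (mem_univ _) fun z _ hzz => ?_
    have hc : z - z₀ ≠ 0 := sub_ne_zero.2 hzz
    have e1 : sandwich K (Φ z) (P z₀ ∘L Q z₀) (Ψ z₀) = sandwich K (Φ z₀) (P z₀ ∘L Q z₀) (Ψ z₀) +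
        (z - z₀) • sandwich K (Φ' z) (P z₀ ∘L Q z₀) (Ψ z₀) := by
      rw [← sandwich_add_smul_left, ← eΦ]
    have e2 : sandwich K (Φ z) (P z ∘L Q z₀) (Ψ z₀) = sandwich K (Φ z) (P z₀ ∘L Q z₀) (Ψ z₀) +
        (z - z₀) • sandwich K (Φ z) (P' z ∘L Q z₀) (Ψ z₀) := by
      rw [← sandwich_add_smul_middle, ← ContinuousLinearMap.smul_comp, ← ContinuousLinearMap.add_comp,
        ← eP]
    have e3 : sandwich K (Φ z) (P z ∘L Q z) (Ψ z₀) = sandwich K (Φ z) (P z ∘L Q z₀) (Ψ z₀) +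
        (z - z₀) • sandwich K (Φ z) (P z ∘L Q' z) (Ψ z₀) := by
      rw [← sandwich_add_smul_middle, ← ContinuousLinearMap.comp_smul, ← ContinuousLinearMap.comp_add,
        ← eQ]
    have e4 : sandwich K (Φ z) (P z ∘L Q z) (Ψ z) = sandwich K (Φ z) (P z ∘L Q z) (Ψ z₀) +
        (z - z₀) • sandwich K (Φ z) (P z ∘L Q z) (Ψ' z) := by
      rw [← sandwich_add_smul_right, ← eΨ]
    have hpow : ((z - z₀) ^ (m + 1))⁻¹ * (z - z₀) = ((z - z₀) ^ m)⁻¹ := by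
      field_simp
      ring
    rw [e4, e3, e2, e1]
    simp only [smul_add, smul_smul, hpow]

/-! ### The perturbed resolvent and its continuation -/

theorem norm_cutL2_le (K : TopologicalSpace.Compacts E3) : ‖cutL2 K‖ ≤ 1 :=
  LinearMap.mkContinuous_norm_le _ zero_le_one _

section Perturbation

variable {V : LInfty} {K : TopologicalSpace.Compacts E3}

theorem cutL2_mulOp (hV : ∀ᵐ x, x ∉ K → V x = 0) (f : L2) : cutL2 K (mulOp V f) = mulOp V f := by
  apply cutL2_eq_self
  filter_upwards [hV, Lp.coeFn_lpSMul (r := 2) V f] with x h1 h2 hx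
  rw [mulOp_apply, h2, Pi.smul_apply', h1 hx, zero_smul]

theorem mulOp_cutL2 (hV : ∀ᵐ x, x ∉ K → V x = 0) (f : L2) : mulOp V (cutL2 K f) = mulOp V f := by
  apply Lp.ext
  filter_upwards [hV, Lp.coeFn_lpSMul (r := 2) V f, Lp.coeFn_lpSMul (r := 2) V (cutL2 K f),
    coeFn_cutLoc K (toLoc f)] with x h1 h2 h3 h4
  rw [mulOp_apply, mulOp_apply, h2, h3, Pi.smul_apply', Pi.smul_apply', cutL2_apply, h4]
  by_cases hx : x ∈ (K : Set E3)
  · rw [indicator_of_mem hx, toAEEqFun_toLoc]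
  · rw [h1 hx, zero_smul, zero_smul]

/-- The norm is at most `‖V‖ (Im z)⁻²`, and `(‖V‖ + 1)² > ‖V‖`. The added `1` keeps the threshold
positive also for `V = 0`. -/
theorem norm_mulOp_comp_freeResolvent_lt {z : ℂ} (hz : ‖V‖ + 1 < z.im) :
    ‖mulOp V ∘L freeResolvent z‖ < 1 := by
  have h0 := norm_nonneg V
  have hz0 : 0 < z.im := by linarith
  calc ‖mulOp V ∘L freeResolvent z‖ ≤ ‖mulOp V‖ * ‖freeResolvent z‖ :=
        ContinuousLinearMap.opNorm_comp_le _ _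
    _ ≤ ‖V‖ * (z.im ^ 2)⁻¹ := by
        gcongr
        · exact norm_mulOp_le V
        · exact norm_freeResolvent_le hz0
    _ < 1 := by
        rw [← div_eq_mul_inv, div_lt_one (by positivity)]
        nlinarith

theorem isUnit_one_add_of_norm_lt_one {T : L2 →L[ℂ] L2} (h : ‖T‖ < 1) : IsUnit (1 + T) := by
  have := isUnit_one_sub_of_norm_lt_one (x := -T) (by rwa [norm_neg])
  rwa [sub_neg_eq_add] at this

/-- The resolvent `(-Δ + V - z²)⁻¹` for large `Im z`. -/
def perturbedResolvent (V : LInfty) (z : ℂ) : L2 →L[ℂ] L2 :=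
  freeResolvent z ∘L Ring.inverse (1 + mulOp V ∘L freeResolvent z)

theorem perturbedResolvent_eq_iff {z : ℂ} (hz : ‖V‖ + 1 < z.im) (f u : L2) :
    perturbedResolvent V z f = u ↔ u = freeResolvent z (f - mulOp V u) := by
  have hu : IsUnit (1 + mulOp V ∘L freeResolvent z) :=
    isUnit_one_add_of_norm_lt_one (norm_mulOp_comp_freeResolvent_lt hz)
  constructor
  · rintro rfl
    set h := Ring.inverse (1 + mulOp V ∘L freeResolvent z) f with hh
    have h1 : h + mulOp V (freeResolvent z h) = f := apply_ringInverse hu f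
    change freeResolvent z h = freeResolvent z (f - mulOp V (freeResolvent z h))
    rw [← h1, add_sub_cancel_right]
  · intro h
    set g := f - mulOp V u with hg
    have h1 : (1 + mulOp V ∘L freeResolvent z) g = f := by
      change g + mulOp V (freeResolvent z g) = f
      rw [← h, hg, sub_add_cancel]
    have h2 := ringInverse_apply hu g
    rw [h1] at h2
    change freeResolvent z (Ring.inverse (1 + mulOp V ∘L freeResolvent z) f) = u
    rw [h2, ← h]

theorem isResolvent_perturbedResolvent {z : ℂ} (hz : ‖V‖ + 1 < z.im) :
    IsResolvent V z (perturbedResolvent V z) := by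
  intro f u
  have h0 := norm_nonneg V
  rw [perturbedResolvent_eq_iff hz, schrodingerGraph_iff_eq_freeResolvent V (by linarith)]

theorem differentiableOn_perturbedResolvent (V : LInfty) :
    DifferentiableOn ℂ (perturbedResolvent V) {z | ‖V‖ + 1 < z.im} := by
  have hfree : DifferentiableOn ℂ freeResolvent {z | ‖V‖ + 1 < z.im} :=
    differentiableOn_freeResolvent.mono fun z hz => by
      have h0 := norm_nonneg V
      have hz' : ‖V‖ + 1 < z.im := hz
      change 0 < z.im
      linarith
  refine hfree.clm_comp (differentiableOn_ringInverse ?_ fun z hz =>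
    isUnit_one_add_of_norm_lt_one (norm_mulOp_comp_freeResolvent_lt hz))
  exact ((differentiableOn_const _).clm_comp hfree).const_add _

theorem isHolomorphicFamilyOn_outgoing (U : Set ℂ) : IsHolomorphicFamilyOn outgoing U :=
  isHolomorphicFamilyOn_radialOp isHolomorphicRadial_expRadial U

/-- The bounded operator `1_K R₀(z) 1_K`, where `R₀(z)` is the free outgoing resolvent. -/
def cutOutgoing (K : TopologicalSpace.Compacts E3) : ℂ → L2 →L[ℂ] L2 :=
  (isHolomorphicFamilyOn_outgoing univ K K).choose

theorem differentiable_cutOutgoing (K : TopologicalSpace.Compacts E3) :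
    Differentiable ℂ (cutOutgoing K) :=
  differentiableOn_univ.1 (isHolomorphicFamilyOn_outgoing univ K K).choose_spec.1

theorem cutOutgoing_apply (K : TopologicalSpace.Compacts E3) (z : ℂ) (f : L2) :
    cutOutgoing K z f = cutLoc K (outgoing z (cutComp K f)) :=
  (isHolomorphicFamilyOn_outgoing univ K K).choose_spec.2 z (mem_univ z) f

/-- The operator `V R₀(z) 1_K`. -/
def birmanSchwinger (V : LInfty) (K : TopologicalSpace.Compacts E3) (z : ℂ) : L2 →L[ℂ] L2 :=
  mulOp V ∘L cutOutgoing K z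

theorem differentiable_birmanSchwinger (V : LInfty) (K : TopologicalSpace.Compacts E3) :
    Differentiable ℂ (birmanSchwinger V K) :=
  (differentiable_const _).clm_comp (differentiable_cutOutgoing K)

theorem isFiniteRankLimit_birmanSchwinger (V : LInfty) (K : TopologicalSpace.Compacts E3) (z : ℂ) :
    IsFiniteRankLimit (birmanSchwinger V K z) :=
  (isFiniteRankLimit_of_eq_truncation_radialOp (K := K) (L := K) (φ := expRadial z)
    (cutOutgoing_apply K z)).comp_left _

theorem birmanSchwinger_apply (hV : ∀ᵐ x, x ∉ K → V x = 0) {z : ℂ} (hz : 0 < z.im) (f : L2) :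
    birmanSchwinger V K z f = mulOp V (freeResolvent z (cutL2 K f)) := by
  change mulOp V (cutOutgoing K z f) = _
  rw [cutOutgoing_apply, outgoing_eq_freeResolvent hz, ← cutL2_apply, mulOp_cutL2 hV, coe_cutComp]

theorem isUnit_one_add_birmanSchwinger (hV : ∀ᵐ x, x ∉ K → V x = 0) {z : ℂ}
    (hz : ‖V‖ + 1 < z.im) : IsUnit (1 + birmanSchwinger V K z) := by
  have h0 := norm_nonneg V
  have e : birmanSchwinger V K z = (mulOp V ∘L freeResolvent z) ∘L cutL2 K := by
    ext1 f
    exact birmanSchwinger_apply hV (by linarith) f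
  apply isUnit_one_add_of_norm_lt_one
  rw [e]
  calc _ ≤ ‖mulOp V ∘L freeResolvent z‖ * ‖cutL2 K‖ := ContinuousLinearMap.opNorm_comp_le _ _
    _ ≤ ‖mulOp V ∘L freeResolvent z‖ * 1 := by
        gcongr
        exact norm_cutL2_le K
    _ < 1 := by
        rw [mul_one]
        exact norm_mulOp_comp_freeResolvent_lt hz

/-- The continued resolvent `R₀ - R₀ 1_K (1 + V R₀ 1_K)⁻¹ V R₀`. -/
def continuedResolvent (V : LInfty) (K : TopologicalSpace.Compacts E3) (z : ℂ) :
    L2Comp →ₗ[ℂ] L2Loc :=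
  outgoing z + (-1 : ℂ) • sandwich K (expRadial z)
    (Ring.inverse (1 + birmanSchwinger V K z) ∘L mulOp V) (expRadial z)

/-- Put `w = R₀f`, let `v` solve `v + V R₀ 1_K v = Vw`, and set `u = w - R₀ 1_K v`. Then `Vu = v`,
so `v` lives on `K`, the cutoff disappears, and `u = R₀(f - Vu)`. -/
theorem continuedResolvent_eq (hV : ∀ᵐ x, x ∉ K → V x = 0) {z : ℂ} (hz : ‖V‖ + 1 < z.im)
    (f : L2Comp) : continuedResolvent V K z f = toLoc (perturbedResolvent V z f) := by
  have h0 := norm_nonneg V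
  have hz0 : 0 < z.im := by linarith
  set w : L2 := freeResolvent z f with hw
  set v : L2 := Ring.inverse (1 + birmanSchwinger V K z) (mulOp V w) with hv
  have h1 : v + mulOp V (freeResolvent z (cutL2 K v)) = mulOp V w := by
    rw [← birmanSchwinger_apply hV hz0]
    exact apply_ringInverse (isUnit_one_add_birmanSchwinger hV hz) _
  have h2 : continuedResolvent V K z f = toLoc (w - freeResolvent z (cutL2 K v)) := by
    rw [continuedResolvent, LinearMap.add_apply, LinearMap.smul_apply, sandwich_apply]
    change outgoing z f + (-1 : ℂ) • outgoing z (cutComp K (Ring.inverse (1 + birmanSchwinger V K z)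
      (mulOp V (cutLoc K (outgoing z f))))) = _
    rw [outgoing_eq_freeResolvent hz0, outgoing_eq_freeResolvent hz0, ← cutL2_apply,
      mulOp_cutL2 hV, coe_cutComp, map_sub, neg_one_smul, sub_eq_add_neg]
  have h3 : mulOp V (w - freeResolvent z (cutL2 K v)) = v := by
    rw [map_sub, ← h1, add_sub_cancel_right]
  rw [h2]
  congr 1
  symm
  rw [perturbedResolvent_eq_iff hz, map_sub, h3]
  congr 2
  rw [← h3, cutL2_mulOp hV]

/-- The points at which `1 + V R₀ 1_K` is not invertible. -/
def exceptionalSet (V : LInfty) (K : TopologicalSpace.Compacts E3) : Set ℂ :=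
  {z | ¬ IsUnit (1 + birmanSchwinger V K z)}

theorem isHolomorphicFamilyOn_continuedResolvent (V : LInfty) (K : TopologicalSpace.Compacts E3) :
    IsHolomorphicFamilyOn (continuedResolvent V K) (exceptionalSet V K)ᶜ := by
  refine (isHolomorphicFamilyOn_outgoing _).add (IsHolomorphicFamilyOn.const_smul
    (isHolomorphicFamilyOn_sandwich K isHolomorphicRadial_expRadial isHolomorphicRadial_expRadial
      (DifferentiableOn.clm_comp (differentiableOn_ringInverse
        ((differentiable_birmanSchwinger V K).const_add 1).differentiableOn fun z hz => ?_)
        (differentiableOn_const _))) _)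
  exact not_not.1 hz

theorem eventually_notMem_exceptionalSet_and_hasFiniteRankPrincipalPartAt
    (hV : ∀ᵐ x, x ∉ K → V x = 0) (z₀ : ℂ) :
    (∀ᶠ z in nhdsWithin z₀ {z₀}ᶜ, z ∉ exceptionalSet V K) ∧
      HasFiniteRankPrincipalPartAt (continuedResolvent V K) z₀ := by
  have h₁ : IsUnit (1 + birmanSchwinger V K ((‖V‖ + 2 : ℝ) * Complex.I)) :=
    isUnit_one_add_birmanSchwinger hV (by simp)
  obtain ⟨U, n, m, D, P, Q, hU, hz, hD, hP, hQ, h⟩ := exists_meromorphic_inverse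
    (differentiable_birmanSchwinger V K) (isFiniteRankLimit_birmanSchwinger V K) h₁ z₀
  constructor
  · filter_upwards [self_mem_nhdsWithin, mem_nhdsWithin_of_mem_nhds (hU.mem_nhds hz)]
      with z hzz hzU
    exact not_not.2 (h z hzU hzz).1
  · have hexp := isHolomorphicRadial_expRadial
    have h1 := (isHolomorphicFamilyOn_outgoing U).add ((isHolomorphicFamilyOn_sandwich K hexp hexp
      (hD.clm_comp (differentiableOn_const (mulOp V)))).const_smul (-1))
    have h2 := hasFiniteRankPrincipalPartAt_sandwich K hU hz m hexp hexp hP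
      (hQ.clm_comp (differentiableOn_const (mulOp V)))
    refine ((h1.hasFiniteRankPrincipalPartAt hU hz).add h2).congr hU hz fun z hzU hzz => ?_
    -- The sandwich is affine in its middle factor, so the splitting of the inverse separates a
    -- holomorphic term from one with the factor `(z - z₀)⁻ᵐ` that passes through `ℂⁿ`.
    have e : Ring.inverse (1 + birmanSchwinger V K z) ∘L mulOp V =
        D z ∘L mulOp V + (-((z - z₀) ^ m)⁻¹) • (P z ∘L (Q z ∘L mulOp V)) := by
      rw [(h z hzU hzz).2]
      ext1 f
      simp [sub_eq_add_neg]
    rw [continuedResolvent, e, sandwich_add_smul_middle, smul_add, smul_smul, add_assoc]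
    congr 3
    ring

end Perturbation

/-! ### Poles, removable singularities and existence -/

open Filter Topology

/-- Multiplied by `(z - z₀)^J`, the principal part tends to its leading coefficient, while a
difference of holomorphic families tends to `0` because `J ≥ 1`. All truncations of `a J` would
vanish. -/
theorem HasFiniteRankPoleAt.not_eventually_eq {A B : ℂ → L2Comp →ₗ[ℂ] L2Loc} {z₀ : ℂ} {W : Set ℂ}
    (hA : HasFiniteRankPoleAt A z₀) (hW : IsOpen W) (hz₀ : z₀ ∈ W) (hB : IsHolomorphicFamilyOn B W) :
    ¬ ∀ᶠ z in 𝓝[≠] z₀, A z = B z := by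
  intro heq
  obtain ⟨J, hJ, a, A₀, U, -, haJ, hU, hzU, hA₀, hAz⟩ := hA
  refine haJ (eq_of_truncation_eq fun K L f => ?_)
  obtain ⟨T₀, hT₀, hT₀'⟩ := hA₀ K L
  obtain ⟨T₁, hT₁, hT₁'⟩ := hB K L
  have hc₀ : ContinuousAt T₀ z₀ := (hT₀.differentiableAt (hU.mem_nhds hzU)).continuousAt
  have hc₁ : ContinuousAt T₁ z₀ := (hT₁.differentiableAt (hW.mem_nhds hz₀)).continuousAt
  have hev : ∀ᶠ z in 𝓝[≠] z₀, ∑ j ∈ Finset.Icc 1 J, (z - z₀) ^ (J - j) • truncation K L (a j) f =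
      (z - z₀) ^ J • (T₁ z f - T₀ z f) := by
    filter_upwards [heq, self_mem_nhdsWithin, mem_nhdsWithin_of_mem_nhds (hU.mem_nhds hzU),
      mem_nhdsWithin_of_mem_nhds (hW.mem_nhds hz₀)] with z hz hzz hzU hzW
    have hne : z - z₀ ≠ 0 := sub_ne_zero.2 hzz
    have h1 : T₁ z f - T₀ z f =
        ∑ j ∈ Finset.Icc 1 J, ((z - z₀) ^ j)⁻¹ • truncation K L (a j) f := by
      rw [hT₁' z hzW, hT₀' z hzU, ← hz, hAz z hzU hzz, truncation_add, LinearMap.add_apply,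
        add_sub_cancel_right]
      simp [truncation]
    rw [h1, Finset.smul_sum]
    refine Finset.sum_congr rfl fun j hj => ?_
    rw [smul_smul, pow_sub₀ _ hne (Finset.mem_Icc.1 hj).2]
  have hl : Tendsto (fun z => ∑ j ∈ Finset.Icc 1 J, (z - z₀) ^ (J - j) • truncation K L (a j) f)
      (𝓝[≠] z₀) (𝓝 (truncation K L (a J) f)) := by
    have hcont : Continuous fun z =>
        ∑ j ∈ Finset.Icc 1 J, (z - z₀) ^ (J - j) • truncation K L (a j) f := by fun_prop
    have := (hcont.tendsto z₀).mono_left (nhdsWithin_le_nhds (s := {z₀}ᶜ))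
    rwa [Finset.sum_eq_single_of_mem J (Finset.mem_Icc.2 ⟨hJ, le_rfl⟩), Nat.sub_self, pow_zero,
      one_smul] at this
    intro j hj hjJ
    have := (Finset.mem_Icc.1 hj).2
    rw [sub_self, zero_pow (by omega), zero_smul]
  have hr : Tendsto (fun z => (z - z₀) ^ J • (T₁ z f - T₀ z f)) (𝓝[≠] z₀) (𝓝 0) := by
    have hcont : ContinuousAt (fun z => (z - z₀) ^ J • (T₁ z f - T₀ z f)) z₀ := by fun_prop
    have := hcont.tendsto.mono_left (nhdsWithin_le_nhds (s := {z₀}ᶜ))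
    rwa [sub_self, zero_pow (by omega), zero_smul] at this
  rw [tendsto_nhds_unique hl (hr.congr' (hev.mono fun z hz => hz.symm))]
  simp [truncation]

theorem isClosed_and_isDiscrete_of_eventually_notMem {S : Set ℂ}
    (h : ∀ z, ∀ᶠ w in 𝓝[≠] z, w ∉ S) : IsClosed S ∧ IsDiscrete S :=
  isClosed_and_discrete_iff.2 fun z => disjoint_principal_right.2 (h z)

/-- A principal part which is not removable yields a pole. -/
theorem HasFiniteRankPrincipalPartAt.hasFiniteRankPoleAt {A : ℂ → L2Comp →ₗ[ℂ] L2Loc} {z₀ : ℂ}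
    (hA : HasFiniteRankPrincipalPartAt A z₀)
    (hrem : ¬ ∃ (B : ℂ → L2Comp →ₗ[ℂ] L2Loc) (U : Set ℂ), IsOpen U ∧ z₀ ∈ U ∧
      IsHolomorphicFamilyOn B U ∧ ∀ z ∈ U, z ≠ z₀ → A z = B z) :
    HasFiniteRankPoleAt A z₀ := by
  classical
  obtain ⟨J, a, A₀, U, ha, haJ, hU, hzU, hA₀, hAz⟩ := hA
  have hex : ∃ J', J' ≤ J ∧ 1 ≤ J' ∧ a J' ≠ 0 := by
    by_contra! hcon
    refine hrem ⟨A₀, U, hU, hzU, hA₀, fun z hz hzz => ?_⟩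
    rw [hAz z hz hzz, Finset.sum_eq_zero, zero_add]
    intro j hj
    rw [hcon j (Finset.mem_Icc.1 hj).2 (Finset.mem_Icc.1 hj).1, smul_zero]
  obtain ⟨J₁, hJ₁, hJ₁'⟩ := hex
  -- The order of the pole is the largest index with a nonzero coefficient; one exists, since
  -- otherwise the singularity would be removable.
  have hspec := Nat.findGreatest_spec (P := fun j => 1 ≤ j ∧ a j ≠ 0) hJ₁ hJ₁'
  have hle := Nat.findGreatest_le (P := fun j => 1 ≤ j ∧ a j ≠ 0) J
  have hgt := fun j => Nat.findGreatest_is_greatest (P := fun j => 1 ≤ j ∧ a j ≠ 0) (n := J) (k := j)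
  set J₂ := Nat.findGreatest (fun j => 1 ≤ j ∧ a j ≠ 0) J
  have hzero : ∀ j, J₂ < j → a j = 0 := by
    intro j hj
    rcases lt_or_ge J j with h | h
    · exact haJ j h
    · by_contra hne
      exact hgt j hj h ⟨by omega, hne⟩
  refine ⟨J₂, hspec.1, a, A₀, U, fun j _ => ha j, hspec.2, hU, hzU, hA₀, fun z hz hzz => ?_⟩
  rw [hAz z hz hzz, sum_Icc_eq_of_le hle hzero]

/-- The removal of removable singularities. -/
theorem exists_isMeromorphicFamily {A : ℂ → L2Comp →ₗ[ℂ] L2Loc} {S₀ : Set ℂ}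
    (hS₀ : ∀ z, ∀ᶠ w in 𝓝[≠] z, w ∉ S₀) (hA : IsHolomorphicFamilyOn A S₀ᶜ)
    (hpp : ∀ z, HasFiniteRankPrincipalPartAt A z) :
    ∃ (R : ℂ → L2Comp →ₗ[ℂ] L2Loc) (S : Set ℂ), S ⊆ S₀ ∧ IsMeromorphicFamily R S ∧
      ∀ z ∉ S₀, R z = A z := by
  classical
  have hopen : IsOpen S₀ᶜ := (isClosed_and_isDiscrete_of_eventually_notMem hS₀).1.isOpen_compl
  let Removable : ℂ → Prop := fun z₀ =>
    ∃ (B : ℂ → L2Comp →ₗ[ℂ] L2Loc) (U : Set ℂ), IsOpen U ∧ z₀ ∈ U ∧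
      IsHolomorphicFamilyOn B U ∧ ∀ z ∈ U, z ≠ z₀ → A z = B z
  let S : Set ℂ := {z ∈ S₀ | ¬ Removable z}
  -- At a removable point the value is that of the local holomorphic extension; at the remaining
  -- points of `S₀` the value is arbitrary.
  let R : ℂ → L2Comp →ₗ[ℂ] L2Loc := fun z =>
    if h : z ∈ S₀ ∧ Removable z then h.2.choose z else A z
  have hR : ∀ z ∉ S₀, R z = A z := fun z hz => dif_neg fun h => hz h.1
  have hS : S ⊆ S₀ := fun z hz => hz.1
  have hdisc := isClosed_and_isDiscrete_of_eventually_notMem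
    fun z => (hS₀ z).mono fun w hw h => hw (hS h)
  have hpunct : ∀ z, ∃ W, IsOpen W ∧ z ∈ W ∧ ∀ w ∈ W, w ≠ z → w ∉ S₀ := by
    intro z
    obtain ⟨W, hW, hWo, hzW⟩ := eventually_nhds_iff.1 (eventually_nhdsWithin_iff.1 (hS₀ z))
    exact ⟨W, hWo, hzW, hW⟩
  refine ⟨R, S, hS, ⟨hdisc.1, hdisc.2, ?_, fun z₀ hz₀ => ?_⟩, hR⟩
  · refine isHolomorphicFamilyOn_of_locally fun z hz => ?_
    by_cases hzS : z ∈ S₀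
    · have hrem : Removable z := by
        by_contra h
        exact hz ⟨hzS, h⟩
      obtain ⟨hU, hzU, hB, hAB⟩ := hrem.choose_spec.choose_spec
      obtain ⟨W, hWo, hzW, hW⟩ := hpunct z
      refine ⟨hrem.choose_spec.choose ∩ W, hU.inter hWo, ⟨hzU, hzW⟩,
        (hB.mono inter_subset_left).congr fun w hw => ?_⟩
      by_cases hwz : w = z
      · rw [hwz]
        exact dif_pos ⟨hzS, hrem⟩
      · rw [hR w (hW w hw.2 hwz), hAB w hw.1 hwz]
    · exact ⟨S₀ᶜ, hopen, hzS, hA.congr hR⟩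
  · obtain ⟨W, hWo, hzW, hW⟩ := hpunct z₀
    have hRA : ∀ z ∈ W, z ≠ z₀ → R z = A z := fun z hz hzz => hR z (hW z hz hzz)
    refine ((hpp z₀).congr hWo hzW hRA).hasFiniteRankPoleAt ?_
    rintro ⟨B, U, hU, hzU, hB, hRB⟩
    exact hz₀.2 ⟨B, U ∩ W, hU.inter hWo, ⟨hzU, hzW⟩, hB.mono inter_subset_left,
      fun z hz hzz => by rw [← hRA z hz.2 hzz, hRB z hz.1 hzz]⟩

theorem exists_isScatteringResolvent (V : LInfty) (hV : AECompactSupport V) :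
    ∃ (R : ℂ → L2Comp →ₗ[ℂ] L2Loc) (S : Set ℂ), IsScatteringResolvent V R S := by
  obtain ⟨K, hK, hVK⟩ := hV
  lift K to TopologicalSpace.Compacts E3 using hK
  have hpp := fun z =>
    eventually_notMem_exceptionalSet_and_hasFiniteRankPrincipalPartAt hVK z
  obtain ⟨R, S, hS, hmer, hR⟩ := exists_isMeromorphicFamily (fun z => (hpp z).1)
    (isHolomorphicFamilyOn_continuedResolvent V K) fun z => (hpp z).2
  refine ⟨R, S, hmer, ‖V‖ + 1, perturbedResolvent V, differentiableOn_perturbedResolvent V,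
    fun z hz => ?_⟩
  have hz' : z ∉ exceptionalSet V K := not_not.2 (isUnit_one_add_birmanSchwinger hVK hz)
  refine ⟨fun h => hz' (hS h), isResolvent_perturbedResolvent hz, fun f => ?_⟩
  rw [hR z hz', continuedResolvent_eq hVK hz, toAEEqFun_toLoc]

/-! ### Uniqueness of the continuation and of its poles -/

/-- The identity theorem for holomorphic families. -/
theorem IsHolomorphicFamilyOn.eqOn {A B : ℂ → L2Comp →ₗ[ℂ] L2Loc} {U : Set ℂ} (hU : IsOpen U)
    (hU' : IsPreconnected U) (hA : IsHolomorphicFamilyOn A U) (hB : IsHolomorphicFamilyOn B U)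
    {z₁ : ℂ} (hz₁ : z₁ ∈ U) (h : ∀ᶠ z in 𝓝 z₁, A z = B z) : EqOn A B U := by
  intro z hz
  refine eq_of_truncation_eq fun K L f => ?_
  obtain ⟨T, hT, hTA⟩ := hA K L
  obtain ⟨T', hT', hTB⟩ := hB K L
  have heq : EqOn T T' U := by
    refine (hT.analyticOnNhd hU).eqOn_of_preconnected_of_eventuallyEq (hT'.analyticOnNhd hU) hU'
      hz₁ ?_
    filter_upwards [h, hU.mem_nhds hz₁] with w hw hwU
    ext1 g
    rw [hTA w hwU, hTB w hwU, hw]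
  rw [← hTA z hz, ← hTB z hz, heq hz]

theorem IsDiscrete.countable_of_hereditarilyLindelof {S : Set ℂ} (hS : IsDiscrete S) :
    S.Countable :=
  (HereditarilyLindelofSpace.isLindelof S).countable_of_isDiscrete hS

theorem isPreconnected_compl_of_countable {S : Set ℂ} (hS : S.Countable) :
    IsPreconnected Sᶜ := by
  refine (hS.isPathConnected_compl_of_one_lt_rank ?_).isConnected.isPreconnected
  rw [Complex.rank_real_complex]
  exact Nat.one_lt_ofNat

theorem IsDiscrete.eventually_notMem {S : Set ℂ} (hc : IsClosed S) (hS : IsDiscrete S) (z : ℂ) :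
    ∀ᶠ w in 𝓝[≠] z, w ∉ S :=
  disjoint_principal_right.1 (isClosed_and_discrete_iff.1 ⟨hc, hS⟩ z)

/-- The poles of a meromorphic family are determined by its values at the regular points. -/
theorem IsMeromorphicFamily.subset_of_eq {R R' : ℂ → L2Comp →ₗ[ℂ] L2Loc} {S S' : Set ℂ}
    (hR : IsMeromorphicFamily R S) (hR' : IsMeromorphicFamily R' S')
    (h : ∀ z, z ∉ S → z ∉ S' → R z = R' z) : S ⊆ S' := by
  intro z hz
  by_contra hz'
  refine (hR.2.2.2 z hz).not_eventually_eq hR'.1.isOpen_compl hz' hR'.2.2.1 ?_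
  filter_upwards [hR.2.1.eventually_notMem hR.1 z, hR'.2.1.eventually_notMem hR'.1 z] with w hw hw'
  exact h w hw hw'

/-- Above both thresholds the resolvent is determined by the graph of `P_V`. Removing the countable
closed set `S ∪ S'` leaves `ℂ` connected, so the identity theorem propagates the equality. -/
theorem IsScatteringResolvent.eq_of_notMem {V : LInfty} {R R' : ℂ → L2Comp →ₗ[ℂ] L2Loc}
    {S S' : Set ℂ} (hR : IsScatteringResolvent V R S) (hR' : IsScatteringResolvent V R' S') (z : ℂ)
    (hz : z ∉ S) (hz' : z ∉ S') : R z = R' z := by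
  obtain ⟨⟨hSc, hSd, hhol, -⟩, C, T, -, hT⟩ := hR
  obtain ⟨⟨hSc', hSd', hhol', -⟩, C', T', -, hT'⟩ := hR'
  have heq : ∀ w : ℂ, max C C' < w.im → R w = R' w := by
    intro w hw
    obtain ⟨-, hres, hRT⟩ := hT w ((le_max_left _ _).trans_lt hw)
    obtain ⟨-, hres', hRT'⟩ := hT' w ((le_max_right _ _).trans_lt hw)
    ext1 f
    have : T w f = T' w f := (hres _ _).2 ((hres' _ _).1 rfl)
    exact Subtype.ext ((hRT f).trans ((congrArg _ this).trans (hRT' f).symm))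
  let z₁ : ℂ := (max C C' + 1 : ℝ) * Complex.I
  have hz₁ : max C C' < z₁.im := by simp [z₁]
  have hmem : z₁ ∈ (S ∪ S')ᶜ := by
    rintro (h | h)
    · exact (hT z₁ ((le_max_left _ _).trans_lt hz₁)).1 h
    · exact (hT' z₁ ((le_max_right _ _).trans_lt hz₁)).1 h
  have hconn : IsPreconnected (S ∪ S')ᶜ := isPreconnected_compl_of_countable
    (hSd.countable_of_hereditarilyLindelof.union hSd'.countable_of_hereditarilyLindelof)
  refine IsHolomorphicFamilyOn.eqOn (hSc.union hSc').isOpen_compl hconn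
    (hhol.mono (compl_subset_compl.2 subset_union_left))
    (hhol'.mono (compl_subset_compl.2 subset_union_right)) hmem ?_ (not_or.2 ⟨hz, hz'⟩)
  filter_upwards [(isOpen_lt continuous_const Complex.continuous_im).mem_nhds hz₁] with w hw
  exact heq w hw

theorem IsScatteringResolvent.unique {V : LInfty} {R R' : ℂ → L2Comp →ₗ[ℂ] L2Loc}
    {S S' : Set ℂ} (hR : IsScatteringResolvent V R S) (hR' : IsScatteringResolvent V R' S') :
    S = S' ∧ ∀ z ∉ S, R z = R' z := by
  have h := hR.eq_of_notMem hR'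
  have hS : S = S' := (hR.1.subset_of_eq hR'.1 h).antisymm
    (hR'.1.subset_of_eq hR.1 fun z hz' hz => (h z hz hz').symm)
  exact ⟨hS, fun z hz => h z hz (hS ▸ hz)⟩

end

theorem theorem2 (V : LInfty) (hV : AECompactSupport V) :
    ∃ R : ℂ → L2Comp →ₗ[ℂ] L2Loc,
      IsScatteringResolvent V R (scatteringResonances V) ∧
      ∀ (R' : ℂ → L2Comp →ₗ[ℂ] L2Loc) (S' : Set ℂ), IsScatteringResolvent V R' S' →
        S' = scatteringResonances V ∧ ∀ z : ℂ, z ∉ scatteringResonances V → R' z = R z := by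
  obtain ⟨R, S, hR⟩ := exists_isScatteringResolvent V hV
  -- The resonance set is a union over all continuations; by uniqueness they all have the same
  -- poles.
  have hS : scatteringResonances V = S := by
    ext z
    constructor
    · rintro ⟨R', S', hR', hz⟩
      rwa [(hR.unique hR').1]
    · exact fun hz => ⟨R, S, hR, hz⟩
  rw [hS]
  refine ⟨R, hR, fun R' S' hR' => ⟨(hR.unique hR').1.symm, fun z hz => ?_⟩⟩
  exact ((hR.unique hR').2 z hz).symm
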